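/- Let $V=\mathbb{R}^2$ with the standard inner product $(\cdot,\cdot)$, and let $\alpha_1,\alpha_2$ be simple roots of a root system of type $A_2$ in $V$, of squared length $2$ and at angles $-\pi/6$ and $\pi/2$ with the positive $x$-axis; let $\tilde\alpha=\alpha_1+\alpha_2$. For $\alpha\in\{\alpha_1,\alpha_2,\tilde\alpha\}$ and $k\in\mathbb{Z}$ let $s_{\alpha,k}$ be the reflection of $V$ across the line $H_{\alpha,k}=\{v\in V\mid(\alpha,v)=k\}$. Let $W$ be the affine Weyl group of type $\tilde A_2$, that is, the group of affine transformations of $V$ generated by all $s_{\alpha,k}$, with simple reflections $s_0=s_{\tilde\alpha,1}$, $s_1=s_{\alpha_1,0}$, $s_2=s_{\alpha_2,0}$ and the corresponding length function $\ell$. The Bruhat order on $W$ is the partial order generated by the relations $x<rx$, where $r$ is a conjugate of a simple reflection and $\ell(x)<\ell(rx)$. Let $q$ be the center of the fundamental alcove $\{v\mid(\alpha_1,v)>0,\ (\alpha_2,v)>0,\ (\tilde\alpha,v)<1\}$, so that $xq$ is the alcove center of $x\in W$. The fundamental root strips are the three regions $\{v\mid 0\le(\alpha,v)\le 1\}$,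 $\alpha\in\{\alpha_1,\alpha_2,\tilde\alpha\}$. An element $w\in W$ is called spiral if $wq$ lies in a fundamental root strip. The chambers are the connected components of the complement of the union of the fundamental root strips. Let $w\in W$ be non-spiral, and let $\mathcal{C}$ be the chamber containing $wq$. Then there is exactly one choice of $\{\alpha,\beta,\gamma\}=\{\alpha_1,\alpha_2,\tilde\alpha\}$ and $i,j,k\in\{0,1\}$ such that $H_{\alpha,i}$ and $H_{\beta,j}$ are the lines that contain the two boundary rays of $\mathcal{C}$, the ray on $H_{\alpha,i}$ being counterclockwise from $wq$ as seen from the vertex of $\mathcal{C}$, and $H_{\gamma,k}$ is the nearer to $wq$ of the two lines $H_{\gamma,0}$, $H_{\gamma,1}$. Put $$w_0=w,\quad w_1=s_{\alpha,i}\,w,\quad w_5=s_{\beta,j}\,w,\quad w_3=s_{\gamma,k}\,w,\quad w_2=s_{\gamma,k}\,w_1,\quad w_4=s_{\gamma,k}\,w_5 .$$ Then $w_0q,w_1q,\dots,w_5q$ are, in counterclockwise order, the vertices of a non-degenerate convex hexagon $\mathcal{H}_w$, and $$\{x\in W\mid x\le w\}=\{x\in W\mid xq\text{ lies on or inside }\mathcal{H}_w\}.$$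 -/

import Mathlib

namespace AffineA2

noncomputable section

/-- The Euclidean plane. -/
abbrev V : Type := EuclideanSpace ℝ (Fin 2)

/-- The positive roots of the root system of type `A₂`: `root 1` and `root 2` are the simple roots
`α₁`, `α₂`, of squared length `2` and at angles `-π/6` and `π/2` with the positive `x`-axis, and
`root 0` is the highest root `α₁ + α₂`.  Since every root has squared length `2`, roots and coroots
coincide. -/
def root : Fin 3 → V :=
  ![!₂[√6 / 2, √2 / 2], !₂[√6 / 2, -(√2 / 2)], !₂[0, √2]]

theorem root_zero : root 0 = root 1 + root 2 := by
  ext i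
  fin_cases i <;> simp [root]
  ring

theorem inner_root_self (a : Fin 3) : innerₗ V (root a) (root a) = 2 := by
  rw [innerₗ_apply_apply, PiLp.inner_apply, Fin.sum_univ_two]
  fin_cases a <;> simp [root, div_pow] <;> norm_num

theorem inner_root_one_two : inner ℝ (root 1) (root 2) = -1 := by
  have h2 : √2 * √2 = 2 := Real.mul_self_sqrt (by norm_num)
  simp [root, PiLp.inner_apply, Fin.sum_univ_two]
  nlinarith

/-- The root hyperplane (a line) `H_{α,k} = {v | (α, v) = k}`.  As `H_{-α,k} = H_{α,-k}`, the
positive roots suffice to obtain all root hyperplanes. -/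
def hyperplane (a : Fin 3) (k : ℤ) : Set V := {v | inner ℝ (root a) v = (k : ℝ)}

/-- The affine reflection `s_{α,k}` across `H_{α,k}`: the linear reflection `s_α` followed by the
translation by `k α`. -/
def affRefl (a : Fin 3) (k : ℤ) : V ≃ᵃ[ℝ] V :=
  (Module.reflection (inner_root_self a)).toAffineEquiv.trans
    (AffineEquiv.constVAdd ℝ V ((k : ℝ) • root a))

theorem affRefl_apply (a : Fin 3) (k : ℤ) (v : V) :
    affRefl a k v = v - (inner ℝ (root a) v - (k : ℝ)) • root a := by
  simp [affRefl, Module.reflection_apply, innerₗ_apply_apply, sub_smul]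
  abel

/-- The affine Weyl group of type `Ã₂`: the group of affine transformations of the plane generated
by all the reflections `s_{α,k}`. -/
def W : Subgroup (V ≃ᵃ[ℝ] V) :=
  Subgroup.closure (Set.range fun p : Fin 3 × ℤ => affRefl p.1 p.2)

/-- The reflection `s_{α,k}` as an element of `W`. -/
def refl (a : Fin 3) (k : ℤ) : W :=
  ⟨affRefl a k, Subgroup.subset_closure ⟨(a, k), rfl⟩⟩

/-- The simple reflections `s₀ = s_{α₀,1}` (where `α₀` is the highest root), `s₁ = s_{α₁,0}` and
`s₂ = s_{α₂,0}`. -/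
def simple : Fin 3 → W := ![refl 0 1, refl 1 0, refl 2 0]

/-- The length of `w`: the least length of an expression of `w` as a product of simple
reflections. -/
def length (w : W) : ℕ := sInf {n | ∃ l : List (Fin 3), l.length = n ∧ (l.map simple).prod = w}

/-- The reflections of `W`: the conjugates of the simple reflections. -/
def IsReflection (r : W) : Prop := ∃ (u : W) (i : Fin 3), r = u * simple i * u⁻¹

/-- The Bruhat order on `W`: the partial order generated by the relations `x < r x`, where `r` is a
reflection with `ℓ(x) < ℓ(r x)`. -/
def BruhatLE : W → W → Prop :=
  Relation.ReflTransGen fun x y => ∃ r : W, IsReflection r ∧ y = r * x ∧ length x < length y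

/-- The center `q` of the fundamental alcove `{v | (α₁, v) > 0, (α₂, v) > 0, (α₀, v) < 1}`,
an equilateral triangle; see `inner_root_q`. -/
def q : V := (1 / 3 : ℝ) • root 0

/-- `q` lies inside the fundamental alcove, at the same distance from its three sides. -/
theorem inner_root_q :
    inner ℝ (root 1) q = 1 / 3 ∧ inner ℝ (root 2) q = 1 / 3 ∧ 1 - inner ℝ (root 0) q = 1 / 3 := by
  have h1 := inner_root_self 1
  have h2 := inner_root_self 2
  have h0 := inner_root_self 0
  have h12 := inner_root_one_two
  have h21 : inner ℝ (root 2) (root 1) = -1 := by rw [real_inner_comm, h12]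
  rw [innerₗ_apply_apply] at h0 h1 h2
  refine ⟨?_, ?_, ?_⟩
  · rw [q, inner_smul_right, root_zero, inner_add_right, h1, h12]; norm_num
  · rw [q, inner_smul_right, root_zero, inner_add_right, h21, h2]; norm_num
  · rw [q, inner_smul_right, h0]; norm_num

/-- The alcove center `w q`. -/
def center (w : W) : V := (w : V ≃ᵃ[ℝ] V) q

/-- The fundamental root strip `{v | 0 ≤ (α, v) ≤ 1}`. -/
def fundStrip (a : Fin 3) : Set V := {v | 0 ≤ inner ℝ (root a) v ∧ inner ℝ (root a) v ≤ 1}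

/-- `w` is spiral if its alcove belongs to one of the fundamental root strips. -/
def IsSpiral (w : W) : Prop := ∃ a, center w ∈ fundStrip a

/-- The chamber of a non-spiral element `w`: the connected component, containing the alcove center
of `w`, of the complement of the union of the fundamental root strips. -/
def chamber (w : W) : Set V := connectedComponentIn (⋃ a, fundStrip a)ᶜ (center w)

/-- `H_{α,k}` is a wall of the region `C`: the boundary of `C` contains a ray of `H_{α,k}`. -/
def IsWall (C : Set V) (a : Fin 3) (k : ℤ) : Prop :=
  ∃ p d : V, d ≠ 0 ∧ ∀ t : ℝ, 0 ≤ t → p + t • d ∈ frontier C ∩ hyperplane a k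

/-- The oriented area of the parallelogram spanned by two vectors; it is positive exactly when the
counterclockwise angle from the first to the second lies strictly between `0` and `π`. -/
def cross (u v : V) : ℝ := u 0 * v 1 - u 1 * v 0

/-- Names `H_{α,i}`, `H_{β,j}`, `H_{γ,k}` for three root hyperplanes. -/
@[ext]
structure Labels where
  α : Fin 3
  i : ℤ
  β : Fin 3
  j : ℤ
  γ : Fin 3
  k : ℤ

/-- The three hyperplanes attached to a non-spiral element `w`: `α`, `β`, `γ` are the three positive
roots in some order and `i, j, k ∈ {0, 1}`; `H_{α,i}` and `H_{β,j}` are the walls of the chamber of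
`w`, where the first is the one counterclockwise from `w` (as seen from the vertex `v` of the
chamber); `H_{γ,k}` is the nearer to `w` of `H_{γ,0}` and `H_{γ,1}`. -/
structure Labels.IsFor (d : Labels) (w : W) : Prop where
  α_ne_β : d.α ≠ d.β
  γ_ne_α : d.γ ≠ d.α
  γ_ne_β : d.γ ≠ d.β
  i_mem : d.i = 0 ∨ d.i = 1
  j_mem : d.j = 0 ∨ d.j = 1
  k_mem : d.k = 0 ∨ d.k = 1
  wall_α : IsWall (chamber w) d.α d.i
  wall_β : IsWall (chamber w) d.β d.j
  counterclockwise : ∃ v ∈ hyperplane d.α d.i ∩ hyperplane d.β d.j,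
    ∀ p ∈ frontier (chamber w) ∩ hyperplane d.α d.i, p ≠ v → 0 < cross (center w - v) (p - v)
  nearer : Metric.infDist (center w) (hyperplane d.γ d.k) <
    Metric.infDist (center w) (hyperplane d.γ (1 - d.k))

/-- The vertices `w₀ = w`, `w₁ = s_{α,i} w`, `w₂ = s_{γ,k} w₁`, `w₃ = s_{γ,k} w`,
`w₄ = s_{γ,k} w₅`, `w₅ = s_{β,j} w` of the hexagon of `w`. -/
def Labels.vertex (d : Labels) (w : W) : Fin 6 → W :=
  ![w, refl d.α d.i * w, refl d.γ d.k * (refl d.α d.i * w), refl d.γ d.k * w,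
    refl d.γ d.k * (refl d.β d.j * w), refl d.β d.j * w]

/-- The points `P 0, …, P 5` are, in this order, the vertices of a (non-degenerate) convex hexagon
traversed counterclockwise: every other vertex lies strictly to the left of each oriented edge from
`P m` to `P (m + 1)` (indices modulo `6`). -/
def IsConvexHexagon (P : Fin 6 → V) : Prop :=
  ∀ m n : Fin 6, n ≠ m → n ≠ m + 1 → 0 < cross (P (m + 1) - P m) (P n - P m)

/-- The closed region (boundary and interior) of the hexagon of `w`. -/
def Labels.hexagon (d : Labels) (w : W) : Set V :=
  convexHull ℝ (Set.range fun m => center (d.vertex w m))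

end

end AffineA2

namespace AffineA2

/-! Everything is translated into barycentric coordinates for the fundamental alcove, scaled by 3.
Alcove centers become integer triples with sum 3 whose entries share a nonzero residue mod 3, and a
triple determines its element (`center_injective`). Reflecting in coordinate `i` at level `m` sends
`x i` to `6 m - x i` and adds `x i - 3 m` to the other two.

The length of `w` is the number of lines separating its alcove from the fundamental one
(`length_eq_sep`). Hence a reflection raises `x` in the Bruhat order exactly when its line does not
separate `x` from the fundamental alcove, which is the condition `Ascends` (`bruhat_step_iff`).

A set of bounded length that contains `w`, is closed under descending steps, and in which every
element other than `w` has an ascending step that stays inside must be the interval below `w`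
(`bruhatLE_iff_of_steps`). The hexagon has these properties. Descents stay inside because every
chord parallel to a root has its midpoint in the fundamental strip of that root. Ascents exist
because a point outside the chamber of `w` can be reflected towards it, and a point inside the
chamber can cross one of the nearest walls away from the origin alcove, unless it is `w`.

The six chambers are the cones where two barycentric coordinates are both negative or both greater
than 1. This gives two cases, `NegHex` and `PosHex`; the three choices of coordinates are handled
cyclically by an index `l`. For negative coordinates the three label lines meet at the vertex of the
chamber and the hexagon is an orbit of a dihedral group; for positive ones they are not concurrent,
so the cases really differ. -/

/-! ### Integer arithmetic of the two kinds of hexagon. -/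

/-- The six inequalities cutting out the hexagon of the point `(X, Y)` with `X, Y < 0`, in
barycentric coordinates scaled by `3`. -/
def NegHex (X Y x y : ℤ) : Prop :=
  X + 2 * Y ≤ x + 2 * y ∧ x + 2 * y ≤ -2 * X - Y ∧ 2 * X + Y ≤ 2 * x + y ∧
    2 * x + y ≤ -X - 2 * Y ∧ X + 2 * Y ≤ x - y ∧ x - y ≤ -2 * X - Y

/-- The six inequalities cutting out the hexagon of the point `(X, Y)` with `X, Y > 3`, in
barycentric coordinates scaled by `3`. -/
def PosHex (X Y x y : ℤ) : Prop :=
  9 - 2 * X - Y ≤ x + 2 * y ∧ x + 2 * y ≤ X + 2 * Y ∧ 9 - X - 2 * Y ≤ 2 * x + y ∧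
    2 * x + y ≤ 2 * X + Y ∧ 9 - 2 * X - Y ≤ x - y ∧ x - y ≤ X + 2 * Y - 9

/-- The wall `x = 3 m` does not separate the point with coordinate `x` from the fundamental
alcove. -/
def Ascends (x m : ℤ) : Prop := (3 * m < x ∧ m ≤ 0) ∨ (x < 3 * m ∧ 1 ≤ m)

/-- The hexagon is symmetric under the reflection at `x = 0`. The point `(x, y)` lies on the segment
between its ascended image and the mirror image of the latter, so convexity applies. -/
theorem NegHex.of_ascends {X Y x y : ℤ} {m : ℤ} (c : Ascends x m)
    (h : NegHex X Y (6 * m - x) (y + x - 3 * m)) : NegHex X Y x y := by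
  unfold NegHex Ascends at *
  omega

theorem NegHex.of_ascends' {X Y x y : ℤ} {m : ℤ} (c : Ascends (3 - x - y) m)
    (h : NegHex X Y (3 - y - 3 * m) (3 - x - 3 * m)) : NegHex X Y x y := by
  unfold NegHex Ascends at *
  omega

/-- Here there is no mirror symmetry in `x`, but the chords `x + 2 * y = const` have their midpoints
in `0 ≤ x ≤ 3`. A level `3 * m` is never strictly inside that range, so the end of the step nearer
to it is still on the chord. -/
theorem PosHex.of_ascends {X Y x y : ℤ} {m : ℤ} (c : Ascends x m)
    (h : PosHex X Y (6 * m - x) (y + x - 3 * m)) : PosHex X Y x y := by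
  unfold PosHex Ascends at *
  omega

theorem PosHex.of_ascends' {X Y x y : ℤ} {m : ℤ} (c : Ascends (3 - x - y) m)
    (h : PosHex X Y (3 - y - 3 * m) (3 - x - 3 * m)) : PosHex X Y x y := by
  unfold PosHex Ascends at *
  omega

theorem NegHex.swap {X Y x y : ℤ} (h : NegHex X Y x y) : NegHex Y X y x := by
  unfold NegHex at *; omega

theorem PosHex.swap {X Y x y : ℤ} (h : PosHex X Y x y) : PosHex Y X y x := by
  unfold PosHex at *; omega

theorem exists_eq_three_mul_add {x y : ℤ} (hxy : x % 3 = y % 3) (hx3 : x % 3 ≠ 0) :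
    ∃ p r e : ℤ, (e = 1 ∨ e = 2) ∧ x = 3 * p + e ∧ y = 3 * r + e :=
  ⟨x / 3, y / 3, x % 3, by omega, by omega, by omega⟩

/-- The lines `x = 0` and `y = 0` are symmetry axes of the hexagon, so they serve for points outside
the cone of `(X, Y)`; inside it, the nearest outward wall in one of the three directions works. -/
theorem NegHex.exists_ascends {X Y x y : ℤ} (hX : X < 0) (hY : Y < 0) (hXY : X % 3 = Y % 3)
    (hX3 : X % 3 ≠ 0) (hxy : x % 3 = y % 3) (hx3 : x % 3 ≠ 0) (h : NegHex X Y x y)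
    (hne : ¬ (x = X ∧ y = Y)) :
    (∃ m, Ascends x m ∧ NegHex X Y (6 * m - x) (y + x - 3 * m)) ∨
    (∃ m, Ascends y m ∧ NegHex X Y (x + y - 3 * m) (6 * m - y)) ∨
    (∃ m, Ascends (3 - x - y) m ∧ NegHex X Y (3 - y - 3 * m) (3 - x - 3 * m)) := by
  by_cases hx : 0 < x
  · refine .inl ⟨0, ?_⟩; unfold NegHex Ascends at *; omega
  by_cases hy : 0 < y
  · refine .inr (.inl ⟨0, ?_⟩); unfold NegHex Ascends at *; omega
  obtain ⟨P, R, E, hE, rfl, rfl⟩ := exists_eq_three_mul_add hXY hX3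
  obtain ⟨p, r, e, he, rfl, rfl⟩ := exists_eq_three_mul_add hxy hx3
  clear hXY hX3 hxy hx3
  unfold NegHex at h
  -- Reflecting at the nearest lower wall `x = 3 * p` fixes `x + 2 * y` and lowers `2 * x + y` and
  -- `x - y` by `3 * e`, so only two lower bounds can break; `h1` states them, divided by 3.
  by_cases h1 : 2 * P + R + E ≤ 2 * p + r ∧ P + 2 * R + E ≤ p - r - e
  · refine .inl ⟨p, .inl (by omega), ?_⟩; refine ⟨?_, ?_, ?_, ?_, ?_, ?_⟩ <;> omega
  by_cases h2 : P + 2 * R + E ≤ p + 2 * r ∧ 2 * P + R + E ≤ r - p - e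
  · refine .inr (.inl ⟨r, .inl (by omega), ?_⟩); refine ⟨?_, ?_, ?_, ?_, ?_, ?_⟩ <;> omega
  -- For `e = 1, 2` this level is that of the first wall above the third coordinate `3 - x - y`. The
  -- bounds in `h3` need `hne`: at `(X, Y)` itself all three outward steps leave the hexagon.
  refine .inr (.inr ⟨2 - p - r - e, .inr (by omega), ?_⟩)
  have h3 : 2 * P + R + E ≤ 2 * p + r + 2 * e - 3 ∧ P + 2 * R + E ≤ p + 2 * r + 2 * e - 3 := by
    omega
  refine ⟨?_, ?_, ?_, ?_, ?_, ?_⟩ <;> omega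

theorem PosHex.exists_ascends {X Y x y : ℤ} (hX : 3 < X) (hY : 3 < Y) (hXY : X % 3 = Y % 3)
    (hX3 : X % 3 ≠ 0) (hxy : x % 3 = y % 3) (hx3 : x % 3 ≠ 0) (h : PosHex X Y x y)
    (hne : ¬ (x = X ∧ y = Y)) :
    (∃ m, Ascends x m ∧ PosHex X Y (6 * m - x) (y + x - 3 * m)) ∨
    (∃ m, Ascends y m ∧ PosHex X Y (x + y - 3 * m) (6 * m - y)) ∨
    (∃ m, Ascends (3 - x - y) m ∧ PosHex X Y (3 - y - 3 * m) (3 - x - 3 * m)) := by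
  -- The line `3 - x - y = 0` is the symmetry axis of this hexagon. It has to come first, since
  -- reflecting at `x = 3` or `y = 3` is used only for points beyond it.
  by_cases hz : 0 < 3 - x - y
  · refine .inr (.inr ⟨0, ?_⟩); unfold PosHex Ascends at *; omega
  by_cases hx : x < 3
  · refine .inl ⟨1, ?_⟩; unfold PosHex Ascends at *; omega
  by_cases hy : y < 3
  · refine .inr (.inl ⟨1, ?_⟩); unfold PosHex Ascends at *; omega
  obtain ⟨P, R, E, hE, rfl, rfl⟩ := exists_eq_three_mul_add hXY hX3
  obtain ⟨p, r, e, he, rfl, rfl⟩ := exists_eq_three_mul_add hxy hx3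
  clear hXY hX3 hxy hx3
  unfold PosHex at h
  -- Now outward means upward in `x` and `y`, so the walls are `p + 1` and `r + 1`, and only upper
  -- bounds of the increasing forms are at risk.
  by_cases h1 : 2 * p + r + 3 ≤ 2 * P + R + E ∧ p - r + 3 - e ≤ P + 2 * R + E - 3
  · refine .inl ⟨p + 1, .inr (by omega), ?_⟩; refine ⟨?_, ?_, ?_, ?_, ?_, ?_⟩ <;> omega
  by_cases h2 : p + 2 * r + 3 ≤ P + 2 * R + E ∧ 3 - 2 * P - R - E ≤ p - r - 3 + e
  · refine .inr (.inl ⟨r + 1, .inr (by omega), ?_⟩); refine ⟨?_, ?_, ?_, ?_, ?_, ?_⟩ <;> omega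
  refine .inr (.inr ⟨1 - p - r - e, .inl (by omega), ?_⟩)
  have h3 : 2 * p + r + 2 * e ≤ 2 * P + R + E ∧ p + 2 * r + 2 * e ≤ P + 2 * R + E := by
    omega
  refine ⟨?_, ?_, ?_, ?_, ?_, ?_⟩ <;> omega

/-! ### Counting separating lines. -/

/-- The number of root hyperplanes that separate the alcove with scaled barycentric coordinates
`x, y, z` from the fundamental alcove. -/
def sepCount (x y z : ℤ) : ℤ := |x / 3| + |y / 3| + |z / 3|

theorem sepCount_reflect_lt {x y m : ℤ} (hxy : x % 3 = y % 3) (hx3 : x % 3 ≠ 0)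
    (c : Ascends x m) :
    sepCount x y (3 - x - y) < sepCount (6 * m - x) (y + x - 3 * m) (3 - y - 3 * m) := by
  obtain ⟨p, r, e, he, rfl, rfl⟩ := exists_eq_three_mul_add hxy hx3
  unfold sepCount Ascends at *
  rcases he with rfl | rfl <;> grind

theorem sepCount_simple {x y : ℤ} (hxy : x % 3 = y % 3) (hx3 : x % 3 ≠ 0) :
    sepCount (- x) (y + x) (3 - y) ≤ sepCount x y (3 - x - y) + 1 := by
  unfold sepCount
  grind

/-- A simple reflection permutes the lines other than its own, so exactly its own line is lost from
the count. -/
theorem sepCount_simple_of_neg {x y : ℤ} (hxy : x % 3 = y % 3) (hx3 : x % 3 ≠ 0) (hx : x < 0) :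
    sepCount (- x) (y + x) (3 - y) = sepCount x y (3 - x - y) - 1 := by
  unfold sepCount
  grind

/-! ### Barycentric coordinates of the plane. -/

theorem inner_root_two_one : inner ℝ (root 2) (root 1) = -1 := by
  rw [real_inner_comm, inner_root_one_two]

theorem inner_root_self' (a : Fin 3) : inner ℝ (root a) (root a) = (2 : ℝ) := by
  simpa [innerₗ_apply_apply] using inner_root_self a

theorem inner_root_zero (v : V) :
    inner ℝ (root 0) v = inner ℝ (root 1) v + inner ℝ (root 2) v := by
  rw [root_zero, inner_add_left]

theorem inner_root_one (v : V) : inner ℝ (root 1) v = √6 / 2 * v 0 - √2 / 2 * v 1 := by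
  simp [root, PiLp.inner_apply, Fin.sum_univ_two]; ring

theorem inner_root_two (v : V) : inner ℝ (root 2) v = √2 * v 1 := by
  simp [root, PiLp.inner_apply, Fin.sum_univ_two]; ring

/-- The barycentric coordinates of the plane with respect to the vertices of the fundamental
alcove. -/
noncomputable def bary (i : Fin 3) (v : V) : ℝ :=
  if i = 0 then 1 - inner ℝ (root 0) v else inner ℝ (root i) v

/-- The index `k` such that `H_{α_i,k}` is the line on which the `i`-th barycentric coordinate is
`m`. -/
def level (i : Fin 3) (m : ℤ) : ℤ := if i = 0 then 1 - m else m

theorem level_level (i : Fin 3) (m : ℤ) : level i (level i m) = m := by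
  unfold level; split_ifs <;> ring

theorem level_one_sub (i : Fin 3) (m : ℤ) : level i (1 - m) = 1 - level i m := by
  unfold level; split_ifs <;> ring

theorem level_mem {i : Fin 3} {m : ℤ} : (level i m = 0 ∨ level i m = 1) ↔ (m = 0 ∨ m = 1) := by
  unfold level; split_ifs <;> omega

theorem level_mem' {i : Fin 3} {m : ℤ} (h : m = 0 ∨ m = 1) : level i m = 0 ∨ level i m = 1 :=
  level_mem.2 h

theorem bary_add_bary_add_bary (l : Fin 3) (v : V) :
    bary l v + bary (l + 1) v + bary (l + 2) v = 1 := by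
  have := inner_root_zero v
  fin_cases l <;> simp [bary] <;> linarith

theorem bary_add_smul (i : Fin 3) (p d : V) (t : ℝ) :
    bary i (p + t • d) = bary i p + t * (bary i (p + d) - bary i p) := by
  unfold bary
  split_ifs <;> simp only [inner_add_right, inner_smul_right] <;> ring

theorem continuous_bary (i : Fin 3) : Continuous (bary i) := by
  unfold bary
  split_ifs <;> fun_prop

theorem eq_of_inner_root {u v : V} (h1 : inner ℝ (root 1) u = inner ℝ (root 1) v)
    (h2 : inner ℝ (root 2) u = inner ℝ (root 2) v) : u = v := by
  rw [inner_root_one, inner_root_one] at h1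
  rw [inner_root_two, inner_root_two] at h2
  have e2 : u 1 = v 1 := mul_left_cancel₀ (by positivity) h2
  have e1 : u 0 = v 0 := by
    rw [e2] at h1
    exact mul_left_cancel₀ (show (√6 / 2 : ℝ) ≠ 0 by positivity) (by linarith)
  ext i
  fin_cases i <;> assumption

theorem eq_of_bary {u v : V} (h : ∀ i, bary i u = bary i v) : u = v :=
  eq_of_inner_root (by simpa [bary] using h 1) (by simpa [bary] using h 2)

theorem eq_or_eq_add (i l : Fin 3) : i = l ∨ i = l + 1 ∨ i = l + 2 := by
  revert i l; decide

theorem eq_of_bary_add {u v : V} (l : Fin 3) (h1 : bary (l + 1) u = bary (l + 1) v)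
    (h2 : bary (l + 2) u = bary (l + 2) v) : u = v := by
  have h0 : bary l u = bary l v := by
    linarith [bary_add_bary_add_bary l u, bary_add_bary_add_bary l v]
  apply eq_of_bary
  intro i
  rcases eq_or_eq_add i l with rfl | rfl | rfl <;> assumption

theorem exists_bary_eq (l : Fin 3) (x y : ℝ) :
    ∃ v : V, bary (l + 1) v = x ∧ bary (l + 2) v = y := by
  have key : ∀ a b : ℝ, ∃ v : V, inner ℝ (root 1) v = a ∧ inner ℝ (root 2) v = b := by
    intro a b
    refine ⟨((2 * a + b) / 3) • root 1 + ((a + 2 * b) / 3) • root 2, ?_, ?_⟩ <;>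
    · simp only [inner_add_right, inner_smul_right, inner_root_self', inner_root_one_two,
        inner_root_two_one]
      ring
  fin_cases l
  · obtain ⟨v, h1, h2⟩ := key x y
    exact ⟨v, by simpa [bary] using h1, by simpa [bary] using h2⟩
  · obtain ⟨v, h1, h2⟩ := key (1 - x - y) x
    refine ⟨v, by simpa [bary] using h2, ?_⟩
    simp [bary, inner_root_zero, h1, h2]
    ring
  · obtain ⟨v, h1, h2⟩ := key y (1 - x - y)
    refine ⟨v, ?_, by simpa [bary] using h1⟩
    simp [bary, inner_root_zero, h1, h2]

theorem sqrt_three_mul_cross (u v : V) : √3 * cross u v =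
    inner ℝ (root 1) u * inner ℝ (root 2) v - inner ℝ (root 2) u * inner ℝ (root 1) v := by
  have h6 : √6 = √2 * √3 := by rw [← Real.sqrt_mul (by norm_num)]; norm_num
  have h2 : √2 * √2 = 2 := Real.mul_self_sqrt (by norm_num)
  simp only [inner_root_one, inner_root_two, cross, h6]
  linear_combination (-(√3 / 2) * (u 0 * v 1 - u 1 * v 0)) * h2

theorem sqrt_three_mul_cross_sub (l : Fin 3) (p p' r r' : V) : √3 * cross (p - p') (r - r') =
    (bary (l + 1) p - bary (l + 1) p') * (bary (l + 2) r - bary (l + 2) r') -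
      (bary (l + 2) p - bary (l + 2) p') * (bary (l + 1) r - bary (l + 1) r') := by
  rw [sqrt_three_mul_cross]
  fin_cases l <;> simp [bary, inner_sub_right, inner_root_zero] <;> ring

theorem cross_pos_iff (l : Fin 3) (p p' r r' : V) : 0 < cross (p - p') (r - r') ↔
    0 < (bary (l + 1) p - bary (l + 1) p') * (bary (l + 2) r - bary (l + 2) r') -
      (bary (l + 2) p - bary (l + 2) p') * (bary (l + 1) r - bary (l + 1) r') := by
  rw [← sqrt_three_mul_cross_sub, mul_pos_iff_of_pos_left (by positivity)]

theorem mem_hyperplane_level {i : Fin 3} {m : ℤ} {v : V} :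
    v ∈ hyperplane i (level i m) ↔ bary i v = m := by
  unfold hyperplane level bary
  split_ifs with h
  · subst h; simp only [Set.mem_ofPred_eq]; push_cast; constructor <;> intro h <;> linarith
  · rfl

theorem mem_fundStrip {i : Fin 3} {v : V} : v ∈ fundStrip i ↔ 0 ≤ bary i v ∧ bary i v ≤ 1 := by
  unfold fundStrip bary
  split_ifs with h
  · subst h
    simp only [Set.mem_ofPred_eq]
    constructor <;> rintro ⟨h, h'⟩ <;> constructor <;> linarith
  · rfl

theorem norm_root (a : Fin 3) : ‖root a‖ = √2 := by
  rw [← inner_root_self' a, real_inner_self_eq_norm_sq, Real.sqrt_sq (norm_nonneg _)]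

theorem infDist_hyperplane (a : Fin 3) (k : ℤ) (v : V) :
    Metric.infDist v (hyperplane a k) = |inner ℝ (root a) v - k| / √2 := by
  set c : ℝ := inner ℝ (root a) v - k with hc
  have hmem : v - (c / 2) • root a ∈ hyperplane a k := by
    simp only [hyperplane, Set.mem_ofPred_eq, inner_sub_right, inner_smul_right, inner_root_self']
    linarith
  have h2 : √2 * √2 = 2 := Real.mul_self_sqrt (by norm_num)
  apply le_antisymm
  · refine (Metric.infDist_le_dist_of_mem hmem).trans_eq ?_
    rw [dist_eq_norm, sub_sub_cancel, norm_smul, norm_root, Real.norm_eq_abs, abs_div,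
      abs_of_pos (show (0 : ℝ) < 2 by norm_num)]
    rw [eq_div_iff (by positivity), mul_assoc, h2]
    ring
  · refine (Metric.le_infDist ⟨_, hmem⟩).2 fun y hy => ?_
    have hy' : inner ℝ (root a) y = (k : ℝ) := hy
    rw [div_le_iff₀ (by positivity), dist_eq_norm, mul_comm, ← norm_root a, hc, ← hy',
      ← inner_sub_right]
    exact abs_real_inner_le_norm _ _

theorem infDist_hyperplane_level (i : Fin 3) (m : ℤ) (v : V) :
    Metric.infDist v (hyperplane i (level i m)) = |bary i v - m| / √2 := by
  rw [infDist_hyperplane]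
  unfold level bary
  split_ifs with h
  · subst h; rw [← abs_neg]; push_cast; congr 2; ring
  · rfl

/-! ### Reflections and the group in barycentric coordinates. -/

/-- The reflection of the plane across the line on which the `i`-th barycentric coordinate is
`m`. -/
noncomputable def baryRefl (i : Fin 3) (m : ℤ) : W := refl i (level i m)

theorem refl_eq_baryRefl (i : Fin 3) (k : ℤ) : refl i k = baryRefl i (level i k) := by
  rw [baryRefl, level_level]

theorem simple_eq_baryRefl (i : Fin 3) : simple i = baryRefl i 0 := by
  fin_cases i <;> simp [simple, baryRefl, level]

theorem bary_baryRefl_self (i : Fin 3) (m : ℤ) (v : V) :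
    bary i ((baryRefl i m : V ≃ᵃ[ℝ] V) v) = 2 * m - bary i v := by
  simp only [baryRefl, refl, affRefl_apply, bary, level]
  split_ifs with h <;>
    simp only [inner_sub_right, inner_smul_right, h, inner_root_self'] <;> push_cast <;> ring

theorem bary_baryRefl_of_ne {i j : Fin 3} (h : j ≠ i) (m : ℤ) (v : V) :
    bary j ((baryRefl i m : V ≃ᵃ[ℝ] V) v) = bary j v + bary i v - m := by
  simp only [baryRefl, refl, affRefl_apply, bary, level]
  have h01 : inner ℝ (root 0) (root 1) = (1 : ℝ) := by
    rw [inner_root_zero, inner_root_self', inner_root_two_one]; norm_num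
  have h02 : inner ℝ (root 0) (root 2) = (1 : ℝ) := by
    rw [inner_root_zero, inner_root_self', inner_root_one_two]; norm_num
  have h10 : inner ℝ (root 1) (root 0) = (1 : ℝ) := by rw [real_inner_comm, h01]
  have h20 : inner ℝ (root 2) (root 0) = (1 : ℝ) := by rw [real_inner_comm, h02]
  fin_cases i <;> fin_cases j <;> first | exact absurd rfl h | skip
  all_goals
    simp [inner_sub_right, inner_smul_right, h01, h02, h10, h20, inner_root_one_two,
      inner_root_two_one]
    try ring

theorem W_ext {w w' : W}
    (h : ∀ i v, bary i ((w : V ≃ᵃ[ℝ] V) v) = bary i ((w' : V ≃ᵃ[ℝ] V) v)) : w = w' :=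
  Subtype.ext (AffineEquiv.ext fun v => eq_of_bary fun i => h i v)

theorem coe_mul_apply (u w : W) (v : V) :
    ((u * w : W) : V ≃ᵃ[ℝ] V) v = (u : V ≃ᵃ[ℝ] V) ((w : V ≃ᵃ[ℝ] V) v) := rfl

theorem baryRefl_mul_self (i : Fin 3) (m : ℤ) : baryRefl i m * baryRefl i m = 1 := by
  apply W_ext
  intro j v
  rw [coe_mul_apply]
  by_cases h : j = i
  · subst h; simp [bary_baryRefl_self]
  · simp [bary_baryRefl_self, bary_baryRefl_of_ne h]; ring

theorem baryRefl_inv (i : Fin 3) (m : ℤ) : (baryRefl i m)⁻¹ = baryRefl i m :=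
  inv_eq_of_mul_eq_one_left (baryRefl_mul_self i m)

theorem baryRefl_conj_self (i : Fin 3) (k m : ℤ) :
    baryRefl i k * baryRefl i m * baryRefl i k = baryRefl i (2 * k - m) := by
  apply W_ext
  intro j v
  simp only [coe_mul_apply]
  by_cases h : j = i
  · subst h; simp only [bary_baryRefl_self]; push_cast; ring
  · simp only [bary_baryRefl_self, bary_baryRefl_of_ne h]; push_cast; ring

/-- The mirror image of the `j`-line is an `l`-line through the common point of the `i`- and
`j`-lines, where coordinate `l` is `1 - k - m`. -/
theorem baryRefl_conj_of_ne {i j l : Fin 3} (hij : i ≠ j) (hil : i ≠ l) (hjl : j ≠ l) (k m : ℤ) :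
    baryRefl i k * baryRefl j m * baryRefl i k = baryRefl l (1 - k - m) := by
  apply W_ext
  intro n v
  have hs : bary i v + bary j v + bary l v = 1 := by
    have := bary_add_bary_add_bary i v
    have : (j = i + 1 ∧ l = i + 2) ∨ (j = i + 2 ∧ l = i + 1) := by
      clear this; revert i j l; decide
    rcases this with ⟨rfl, rfl⟩ | ⟨rfl, rfl⟩ <;> linarith
  simp only [coe_mul_apply]
  have : n = i ∨ n = j ∨ n = l := by clear hs; revert i j l n; decide
  rcases this with rfl | rfl | rfl <;>
    simp only [bary_baryRefl_self, bary_baryRefl_of_ne hij, bary_baryRefl_of_ne hil,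
      bary_baryRefl_of_ne hjl, bary_baryRefl_of_ne hij.symm, bary_baryRefl_of_ne hil.symm,
      bary_baryRefl_of_ne hjl.symm] <;> push_cast <;> linarith

theorem exists_baryRefl_conj (i j : Fin 3) (k m : ℤ) :
    ∃ l n, baryRefl i k * baryRefl j m * baryRefl i k = baryRefl l n := by
  by_cases h : i = j
  · subst h; exact ⟨_, _, baryRefl_conj_self i k m⟩
  · have : ∃ l, i ≠ l ∧ j ≠ l := by revert i j; decide
    obtain ⟨l, h1, h2⟩ := this
    exact ⟨_, _, baryRefl_conj_of_ne h h1 h2 k m⟩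

theorem W_induction {p : W → Prop} (one : p 1) (mul : ∀ i m w, p w → p (baryRefl i m * w))
    (w : W) : p w := by
  obtain ⟨w, hw⟩ := w
  have mul' : ∀ x ∈ Set.range (fun p : Fin 3 × ℤ => affRefl p.1 p.2),
      ∀ (y) (hy : y ∈ W) (hx : x ∈ W), p ⟨y, hy⟩ → p (⟨x, hx⟩ * ⟨y, hy⟩) := by
    rintro _ ⟨⟨i, k⟩, rfl⟩ y hy hx h
    have := mul i (level i k) _ h
    rwa [← refl_eq_baryRefl] at this
  induction hw using Subgroup.closure_induction_left with
  | one => exact one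
  | mul_left x hx y hy ih => exact mul' x hx y hy (Subgroup.subset_closure hx) ih
  | inv_mul_cancel x hx y hy ih =>
    obtain ⟨⟨i, k⟩, rfl⟩ := hx
    have := mul i (level i k) _ ih
    rw [← baryRefl_inv, ← refl_eq_baryRefl] at this
    exact this

theorem isReflection_iff {r : W} : IsReflection r ↔ ∃ i m, r = baryRefl i m := by
  constructor
  · rintro ⟨u, i, rfl⟩
    rw [simple_eq_baryRefl]
    generalize (0 : ℤ) = m
    induction u using W_induction with
    | one => exact ⟨i, m, by simp⟩
    | mul j k w ih =>
      obtain ⟨l, n, h⟩ := ih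
      obtain ⟨l', n', h'⟩ := exists_baryRefl_conj j l k n
      refine ⟨l', n', ?_⟩
      rw [← h', ← h, mul_inv_rev, baryRefl_inv]
      simp only [mul_assoc]
  · rintro ⟨l, m, rfl⟩
    -- The level `1 - m` is chosen to solve `1 - k - 0 = m` in `baryRefl_conj_of_ne`.
    refine ⟨baryRefl (l + 1) (1 - m), l + 2, ?_⟩
    rw [simple_eq_baryRefl, baryRefl_inv, baryRefl_conj_of_ne (l := l)]
    · congr 1; ring
    all_goals revert l; decide

theorem bary_q (i : Fin 3) : bary i q = 1 / 3 := by
  obtain ⟨h1, h2, h0⟩ := inner_root_q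
  fin_cases i <;> simp [bary] <;> linarith

theorem bary_zero (v : V) : bary 0 v = 1 - bary 1 v - bary 2 v := by
  have := bary_add_bary_add_bary 0 v
  simp only [zero_add] at this
  linarith

/-! ### Freeness on alcove centers and integral coordinates. -/

/-- Every element of `W` acts on the barycentric coordinates `1`, `2` by one of the six matrices of
the finite Weyl group followed by a translation of the root lattice. -/
theorem exists_affine_form (w : W) : ∃ a b c d m n : ℤ,
    ((a = 1 ∧ b = 0 ∧ c = 0 ∧ d = 1) ∨ (a = -1 ∧ b = 0 ∧ c = 1 ∧ d = 1) ∨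
      (a = 1 ∧ b = 1 ∧ c = 0 ∧ d = -1) ∨ (a = 0 ∧ b = -1 ∧ c = -1 ∧ d = 0) ∨
      (a = -1 ∧ b = -1 ∧ c = 1 ∧ d = 0) ∨ (a = 0 ∧ b = 1 ∧ c = -1 ∧ d = -1)) ∧
    (m - n) % 3 = 0 ∧
    ∀ v, bary 1 ((w : V ≃ᵃ[ℝ] V) v) = a * bary 1 v + b * bary 2 v + m ∧
      bary 2 ((w : V ≃ᵃ[ℝ] V) v) = c * bary 1 v + d * bary 2 v + n := by
  induction w using W_induction with
  | one => exact ⟨1, 0, 0, 1, 0, 0, by simp, by simp, by simp⟩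
  | mul i k w ih =>
    obtain ⟨a, b, c, d, m, n, hl, hmn, h⟩ := ih
    obtain rfl | rfl | rfl : i = 0 ∨ i = 1 ∨ i = 2 := eq_or_eq_add i 0
    · refine ⟨-c, -d, -a, -b, 1 - n - k, 1 - m - k, ?_, by omega, fun v => ?_⟩
      · rcases hl with h | h | h | h | h | h <;> obtain ⟨rfl, rfl, rfl, rfl⟩ := h <;> decide
      · rw [coe_mul_apply, bary_baryRefl_of_ne (by decide), bary_baryRefl_of_ne (by decide),
          bary_zero, (h v).1, (h v).2]
        push_cast
        constructor <;> ring
    · refine ⟨-a, -b, a + c, b + d, 2 * k - m, m + n - k, ?_, by omega, fun v => ?_⟩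
      · rcases hl with h | h | h | h | h | h <;> obtain ⟨rfl, rfl, rfl, rfl⟩ := h <;> decide
      · rw [coe_mul_apply, bary_baryRefl_self, bary_baryRefl_of_ne (by decide),
          (h v).1, (h v).2]
        push_cast
        constructor <;> ring
    · refine ⟨a + c, b + d, -c, -d, m + n - k, 2 * k - n, ?_, by omega, fun v => ?_⟩
      · rcases hl with h | h | h | h | h | h <;> obtain ⟨rfl, rfl, rfl, rfl⟩ := h <;> decide
      · rw [coe_mul_apply, bary_baryRefl_self, bary_baryRefl_of_ne (by decide),
          (h v).1, (h v).2]
        push_cast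
        constructor <;> ring

theorem eq_one_of_center_eq {w : W} (hw : center w = q) : w = 1 := by
  obtain ⟨a, b, c, d, m, n, hl, hmn, h⟩ := exists_affine_form w
  have hq := h q
  rw [show (w : V ≃ᵃ[ℝ] V) q = q from hw] at hq
  simp only [bary_q] at hq
  have e1 : a + b + 3 * m = 1 := by
    have : (a + b + 3 * m : ℝ) = 1 := by linarith [hq.1]
    exact_mod_cast this
  have e2 : c + d + 3 * n = 1 := by
    have : (c + d + 3 * n : ℝ) = 1 := by linarith [hq.2]
    exact_mod_cast this
  -- Reflections fail modulo 3; the rotations by 120 degrees about `q` have integral translation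
  -- parts and are excluded only by `hmn`, the root lattice condition.
  have : a = 1 ∧ b = 0 ∧ c = 0 ∧ d = 1 ∧ m = 0 ∧ n = 0 := by omega
  obtain ⟨rfl, rfl, rfl, rfl, rfl, rfl⟩ := this
  refine Subtype.ext (AffineEquiv.ext fun v => eq_of_bary_add 0 ?_ ?_)
  · simpa using (h v).1
  · simpa using (h v).2

theorem center_injective : Function.Injective center := by
  intro x y h
  have : center (y⁻¹ * x) = q := by
    have : center (y⁻¹ * x) = ((y⁻¹ : W) : V ≃ᵃ[ℝ] V) (center x) := rfl
    rw [this, h, center, ← coe_mul_apply]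
    simp
  simpa [inv_mul_eq_one, eq_comm] using eq_one_of_center_eq this

theorem exists_coord (w : W) : ∃ x : Fin 3 → ℤ, (∀ i, 3 * bary i (center w) = x i) ∧
    (∀ i j, x i % 3 = x j % 3) ∧ ∀ i, x i % 3 ≠ 0 := by
  obtain ⟨a, b, c, d, m, n, hl, hmn, h⟩ := exists_affine_form w
  have hq := h q
  simp only [bary_q] at hq
  change bary 1 (center w) = _ ∧ bary 2 (center w) = _ at hq
  refine ⟨![3 - (a + b + 3 * m) - (c + d + 3 * n), a + b + 3 * m, c + d + 3 * n], ?_, ?_, ?_⟩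
  · have h0 := bary_zero (center w)
    intro i
    fin_cases i <;> simp <;> linarith
  · intro i j
    fin_cases i <;> fin_cases j <;> simp only [Fin.mk_zero, Fin.mk_one, Fin.reduceFinMk,
      Matrix.cons_val] <;> omega
  · intro i
    fin_cases i <;> simp only [Fin.mk_zero, Fin.mk_one, Fin.reduceFinMk,
      Matrix.cons_val] <;> omega

/-- The barycentric coordinates of the alcove center of `w`, scaled by `3`. -/
noncomputable def coord (w : W) : Fin 3 → ℤ := (exists_coord w).choose

theorem coord_cast (w : W) (i : Fin 3) : (coord w i : ℝ) = 3 * bary i (center w) :=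
  ((exists_coord w).choose_spec.1 i).symm

theorem coord_emod (w : W) (i j : Fin 3) : coord w i % 3 = coord w j % 3 :=
  (exists_coord w).choose_spec.2.1 i j

theorem coord_emod_ne (w : W) (i : Fin 3) : coord w i % 3 ≠ 0 :=
  (exists_coord w).choose_spec.2.2 i

theorem coord_add (w : W) (l : Fin 3) : coord w l + coord w (l + 1) + coord w (l + 2) = 3 := by
  have := bary_add_bary_add_bary l (center w)
  have : (coord w l + coord w (l + 1) + coord w (l + 2) : ℝ) = 3 := by
    simp only [coord_cast]; linarith
  exact_mod_cast this

theorem center_mul (u w : W) : center (u * w) = (u : V ≃ᵃ[ℝ] V) (center w) := rfl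

theorem coord_baryRefl_self (w : W) (i : Fin 3) (m : ℤ) :
    coord (baryRefl i m * w) i = 6 * m - coord w i := by
  have : (coord (baryRefl i m * w) i : ℝ) = 6 * m - coord w i := by
    rw [coord_cast, coord_cast, center_mul, bary_baryRefl_self]; ring
  exact_mod_cast this

theorem coord_baryRefl_of_ne (w : W) {i j : Fin 3} (h : j ≠ i) (m : ℤ) :
    coord (baryRefl i m * w) j = coord w j + coord w i - 3 * m := by
  have : (coord (baryRefl i m * w) j : ℝ) = coord w j + coord w i - 3 * m := by
    simp only [coord_cast, center_mul, bary_baryRefl_of_ne h]; ring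
  exact_mod_cast this

theorem coord_baryRefl_add_one (w : W) (i : Fin 3) (m : ℤ) :
    coord (baryRefl i m * w) (i + 1) = coord w (i + 1) + coord w i - 3 * m :=
  coord_baryRefl_of_ne w (by revert i; decide) m

theorem eq_of_coord {x y : W} (l : Fin 3) (h1 : coord x (l + 1) = coord y (l + 1))
    (h2 : coord x (l + 2) = coord y (l + 2)) : x = y := by
  apply center_injective
  have h1' := congrArg (Int.cast (R := ℝ)) h1
  have h2' := congrArg (Int.cast (R := ℝ)) h2
  simp only [coord_cast] at h1' h2'
  exact eq_of_bary_add l (by linarith) (by linarith)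

/-! ### Length as the number of separating lines. -/

/-- The number of root hyperplanes that separate the alcove of `w` from the fundamental alcove. -/
noncomputable def sep (w : W) : ℤ := sepCount (coord w 0) (coord w 1) (coord w 2)

theorem sep_eq (w : W) (l : Fin 3) :
    sep w = sepCount (coord w l) (coord w (l + 1)) (coord w (l + 2)) := by
  obtain rfl | rfl | rfl : l = 0 ∨ l = 1 ∨ l = 2 := eq_or_eq_add l 0
  · rfl
  all_goals
    simp only [sep, sepCount, Fin.isValue, Fin.reduceAdd]
    ring

theorem sep_eq' (w : W) (l : Fin 3) :
    sep w = sepCount (coord w l) (coord w (l + 1)) (3 - coord w l - coord w (l + 1)) := by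
  rw [sep_eq w l,
    show coord w (l + 2) = 3 - coord w l - coord w (l + 1) by linarith [coord_add w l]]

theorem sep_nonneg (w : W) : 0 ≤ sep w := by unfold sep sepCount; positivity

theorem sep_lt_sep_baryRefl {w : W} {i : Fin 3} {m : ℤ} (h : Ascends (coord w i) m) :
    sep w < sep (baryRefl i m * w) := by
  have := sepCount_reflect_lt (coord_emod w i (i + 1)) (coord_emod_ne w i) h
  rw [sep_eq' w i, sep_eq' _ i, coord_baryRefl_self, coord_baryRefl_add_one]
  convert this using 2
  ring

theorem sep_simple_le (w : W) (i : Fin 3) : sep (simple i * w) ≤ sep w + 1 := by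
  have := sepCount_simple (coord_emod w i (i + 1)) (coord_emod_ne w i)
  rw [sep_eq' w i, sep_eq' _ i, simple_eq_baryRefl, coord_baryRefl_self, coord_baryRefl_add_one]
  convert this using 2 <;> ring

theorem sep_simple_of_neg {w : W} {i : Fin 3} (h : coord w i < 0) :
    sep (simple i * w) = sep w - 1 := by
  have := sepCount_simple_of_neg (coord_emod w i (i + 1)) (coord_emod_ne w i) h
  rw [sep_eq' w i, sep_eq' _ i, simple_eq_baryRefl, coord_baryRefl_self, coord_baryRefl_add_one]
  convert this using 2 <;> ring

theorem coord_one (i : Fin 3) : coord 1 i = 1 := by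
  have : (coord 1 i : ℝ) = 1 := by
    rw [coord_cast, show center 1 = q from rfl, bary_q]; norm_num
  exact_mod_cast this

/-- Three positive integers with sum 3 are all 1, and no coordinate is 0. This supplies the descents
for `exists_word`. -/
theorem eq_one_or_exists_coord_neg (w : W) : w = 1 ∨ ∃ i, coord w i < 0 := by
  by_contra! h
  obtain ⟨h1, h⟩ := h
  apply h1
  have := coord_add w 0
  have g0 := coord_emod_ne w 0
  have g1 := coord_emod_ne w 1
  have g2 := coord_emod_ne w 2
  have k0 := h 0
  have k1 := h 1
  have k2 := h 2
  simp only [zero_add] at this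
  exact eq_of_coord 0 (by simp only [coord_one, zero_add]; omega)
    (by simp only [coord_one, zero_add]; omega)

theorem exists_word (n : ℕ) : ∀ w : W, sep w = n →
    ∃ l : List (Fin 3), l.length = n ∧ (l.map simple).prod = w := by
  induction n with
  | zero =>
    intro w hw
    rcases eq_one_or_exists_coord_neg w with rfl | ⟨i, hi⟩
    · exact ⟨[], by simp⟩
    · have := sep_simple_of_neg hi
      have := sep_nonneg (simple i * w)
      push_cast at hw
      omega
  | succ n ih =>
    intro w hw
    rcases eq_one_or_exists_coord_neg w with rfl | ⟨i, hi⟩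
    · simp [sep, sepCount, coord_one] at hw
      omega
    · have := sep_simple_of_neg hi
      obtain ⟨l, hl, hp⟩ := ih (simple i * w) (by push_cast at hw; omega)
      refine ⟨i :: l, by simp [hl], ?_⟩
      rw [List.map_cons, List.prod_cons, hp, ← mul_assoc, simple_eq_baryRefl, baryRefl_mul_self,
        one_mul]

theorem sep_prod_le (l : List (Fin 3)) : sep (l.map simple).prod ≤ l.length := by
  induction l with
  | nil => simp [sep, sepCount, coord_one]
  | cons i l ih =>
    have := sep_simple_le (l.map simple).prod i
    simp only [List.map_cons, List.prod_cons, List.length_cons]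
    push_cast
    omega

/-- Greedy descent gives a word of length `sep w`; no word is shorter, because a simple reflection
raises `sep` by at most one. -/
theorem length_eq_sep (w : W) : (length w : ℤ) = sep w := by
  obtain ⟨n, hn⟩ := Int.eq_ofNat_of_zero_le (sep_nonneg w)
  obtain ⟨l, hl, hp⟩ := exists_word n w hn
  have hmem : n ∈ {n | ∃ l : List (Fin 3), l.length = n ∧ (l.map simple).prod = w} := ⟨l, hl, hp⟩
  apply le_antisymm
  · rw [hn]; exact_mod_cast Nat.sInf_le hmem
  · obtain ⟨l', hl', hp'⟩ := Nat.sInf_mem ⟨n, hmem⟩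
    have := sep_prod_le l'
    rwa [hp', hl'] at this

theorem length_lt_length_baryRefl_iff {w : W} {i : Fin 3} {m : ℤ} :
    length w < length (baryRefl i m * w) ↔ Ascends (coord w i) m := by
  rw [← Int.ofNat_lt, length_eq_sep, length_eq_sep]
  refine ⟨fun h => ?_, sep_lt_sep_baryRefl⟩
  by_contra hc
  -- A line separates exactly one of an alcove and its mirror image from the fundamental alcove, so
  -- a non-ascending step is the reverse of an ascending one.
  have hasc : Ascends (coord (baryRefl i m * w) i) m := by
    have := coord_emod_ne w i
    rw [coord_baryRefl_self]
    unfold Ascends at *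
    omega
  have := sep_lt_sep_baryRefl hasc
  rw [← mul_assoc, baryRefl_mul_self, one_mul] at this
  omega

/-! ### The Bruhat order and a criterion for lower intervals. -/

/-- The relation generating the Bruhat order, in barycentric coordinates. -/
theorem bruhat_step_iff {x y : W} :
    (∃ r : W, IsReflection r ∧ y = r * x ∧ length x < length y) ↔
      ∃ i m, y = baryRefl i m * x ∧ Ascends (coord x i) m := by
  constructor
  · rintro ⟨r, hr, rfl, h⟩
    obtain ⟨i, m, rfl⟩ := isReflection_iff.1 hr
    exact ⟨i, m, rfl, length_lt_length_baryRefl_iff.1 h⟩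
  · rintro ⟨i, m, rfl, h⟩
    exact ⟨_, isReflection_iff.2 ⟨i, m, rfl⟩, rfl, length_lt_length_baryRefl_iff.2 h⟩

/-- A set of elements that contains `w`, is closed under descending steps, and every other element
of which has an ascending step inside the set, is a lower Bruhat interval if lengths are bounded
on it. -/
theorem bruhatLE_iff_of_steps {w : W} {S : W → Prop} (hw : S w)
    (down : ∀ x i m, Ascends (coord x i) m → S (baryRefl i m * x) → S x)
    (up : ∀ x, S x → x ≠ w → ∃ i m, Ascends (coord x i) m ∧ S (baryRefl i m * x))
    (N : ℤ) (bdd : ∀ x, S x → sep x ≤ N) (x : W) : BruhatLE x w ↔ S x := by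
  constructor
  · intro h
    induction h using Relation.ReflTransGen.head_induction_on with
    | refl => exact hw
    | head h _ ih =>
      obtain ⟨i, m, rfl, ha⟩ := bruhat_step_iff.1 h
      exact down _ i m ha ih
  -- Each ascent raises `sep`, which is at most `N` on `S`; the climb can only stop at `w`.
  · have key : ∀ n : ℕ, ∀ x, S x → N - sep x ≤ n → BruhatLE x w := by
      intro n
      induction n with
      | zero =>
        intro x hx hn
        by_cases hxw : x = w
        · subst hxw; exact Relation.ReflTransGen.refl
        obtain ⟨i, m, ha, hS⟩ := up x hx hxw
        have h1 := sep_lt_sep_baryRefl ha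
        have h2 := bdd _ hS
        push_cast at hn
        omega
      | succ n ih =>
        intro x hx hn
        by_cases hxw : x = w
        · subst hxw; exact Relation.ReflTransGen.refl
        obtain ⟨i, m, ha, hS⟩ := up x hx hxw
        have h1 := sep_lt_sep_baryRefl ha
        refine Relation.ReflTransGen.head (bruhat_step_iff.2 ⟨i, m, rfl, ha⟩) (ih _ hS ?_)
        push_cast at hn
        omega
    exact fun hx => key (N - sep x).toNat x hx (Int.self_le_toNat _)

/-! ### Chambers and their walls. -/

/-- The open cone bounded by the lines on which the barycentric coordinates `l + 1` and `l + 2` are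
`e`; it lies on the negative side of both if `e = 0`, and on the positive side of both if
`e = 1`. -/
def cone (l : Fin 3) (e : ℤ) : Set V :=
  {v | 0 < (2 * e - 1) * (bary (l + 1) v - e) ∧ 0 < (2 * e - 1) * (bary (l + 2) v - e)}

theorem bary_lt_or_gt_of_not_mem_fundStrip {v : V} {i : Fin 3} (h : v ∉ fundStrip i) :
    bary i v < 0 ∨ 1 < bary i v := by
  rw [mem_fundStrip] at h
  by_contra! hc
  exact h hc

theorem exists_center_mem_cone {w : W} (hw : ¬ IsSpiral w) :
    ∃ l e, (e = 0 ∨ e = 1) ∧ center w ∈ cone l e := by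
  have h : ∀ i, bary i (center w) < 0 ∨ 1 < bary i (center w) := fun i =>
    bary_lt_or_gt_of_not_mem_fundStrip fun hi => hw ⟨i, hi⟩
  have hs := bary_add_bary_add_bary 0 (center w)
  have neg : ∀ l, bary (l + 1) (center w) < 0 → bary (l + 2) (center w) < 0 →
      ∃ l e, (e = 0 ∨ e = 1) ∧ center w ∈ cone l e := fun l h1 h2 =>
    ⟨l, 0, .inl rfl, by constructor <;> push_cast <;> linarith⟩
  have pos : ∀ l, 1 < bary (l + 1) (center w) → 1 < bary (l + 2) (center w) →
      ∃ l e, (e = 0 ∨ e = 1) ∧ center w ∈ cone l e := fun l h1 h2 =>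
    ⟨l, 1, .inr rfl, by constructor <;> push_cast <;> linarith⟩
  simp only [zero_add] at hs
  rcases h 0 with h0 | h0 <;> rcases h 1 with h1 | h1 <;> rcases h 2 with h2 | h2
  · linarith
  · exact neg 2 h0 h1
  · exact neg 1 h2 h0
  · exact pos 0 h1 h2
  · exact neg 0 h1 h2
  · exact pos 1 h2 h0
  · exact pos 2 h0 h1
  · linarith

theorem convex_cone (l : Fin 3) (e : ℤ) : Convex ℝ (cone l e) := by
  intro u hu v hv a b ha hb hab
  have key : ∀ i, bary i (a • u + b • v) = a * bary i u + b * bary i v := by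
    intro i
    have h := bary_add_smul i u (v - u) b
    have e1 : u + b • (v - u) = a • u + b • v := by
      rw [← eq_sub_iff_add_eq] at hab; subst hab; module
    rw [e1, add_sub_cancel] at h
    rw [h]
    linear_combination (-bary i u) * hab
  have gen : ∀ x y : ℝ, 0 < (2 * (e : ℝ) - 1) * (x - e) → 0 < (2 * (e : ℝ) - 1) * (y - e) →
      0 < (2 * (e : ℝ) - 1) * (a * x + b * y - e) := by
    intro x y hx hy
    have : (2 * (e : ℝ) - 1) * (a * x + b * y - e) =
        a * ((2 * (e : ℝ) - 1) * (x - e)) + b * ((2 * (e : ℝ) - 1) * (y - e)) := by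
      linear_combination (-(2 * (e : ℝ) - 1) * e) * hab.symm
    rw [this]
    rcases ha.eq_or_lt with rfl | ha
    · have : b = 1 := by linarith
      subst this; linarith
    · positivity
  exact ⟨by rw [key]; exact gen _ _ hu.1 hv.1, by rw [key]; exact gen _ _ hu.2 hv.2⟩

theorem isOpen_cone (l : Fin 3) (e : ℤ) : IsOpen (cone l e) := by
  have g : ∀ i, Continuous fun v => (2 * (e : ℝ) - 1) * (bary i v - e) := fun i =>
    continuous_const.mul ((continuous_bary i).sub continuous_const)
  exact (isOpen_lt continuous_const (g _)).inter (isOpen_lt continuous_const (g _))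

theorem cone_subset {l : Fin 3} {e : ℤ} (he : e = 0 ∨ e = 1) :
    cone l e ⊆ (⋃ a, fundStrip a)ᶜ := by
  intro v hv hmem
  obtain ⟨i, hi⟩ := Set.mem_iUnion.1 hmem
  rw [mem_fundStrip] at hi
  have hs := bary_add_bary_add_bary l v
  obtain ⟨h1, h2⟩ := hv
  rcases he with rfl | rfl <;> push_cast at h1 h2 <;>
    rcases eq_or_eq_add i l with rfl | rfl | rfl <;> linarith

theorem chamber_eq_cone {w : W} {l : Fin 3} {e : ℤ} (he : e = 0 ∨ e = 1)
    (hw : center w ∈ cone l e) : chamber w = cone l e := by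
  apply subset_antisymm
  · intro y hy
    have hpre : IsPreconnected (chamber w) := isPreconnected_connectedComponentIn
    have hc : center w ∈ chamber w := mem_connectedComponentIn (cone_subset he hw)
    have avoid : ∀ z ∈ chamber w, ∀ i, bary i z < 0 ∨ 1 < bary i z := fun z hz i =>
      bary_lt_or_gt_of_not_mem_fundStrip fun hi =>
        connectedComponentIn_subset _ _ hz (Set.mem_iUnion.2 ⟨i, hi⟩)
    have half : ∀ u ∈ chamber w, ∀ v ∈ chamber w, ∀ i, bary i u < 0 → ¬ 1 < bary i v := by
      intro u hu v hv i h0 h1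
      -- A connected set meeting both sides of a strip would contain a point at level `1 / 2`,
      -- inside the strip.
      obtain ⟨z, hz, hz'⟩ := hpre.intermediate_value hu hv (continuous_bary i).continuousOn
        (show (1 / 2 : ℝ) ∈ Set.Icc (bary i u) (bary i v) by constructor <;> linarith)
      rcases avoid z hz i with h | h <;> linarith
    obtain ⟨h1, h2⟩ := hw
    rcases he with rfl | rfl <;> push_cast at h1 h2
    · have k1 := (avoid y hy (l + 1)).resolve_right (half _ hc _ hy _ (by linarith))
      have k2 := (avoid y hy (l + 2)).resolve_right (half _ hc _ hy _ (by linarith))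
      constructor <;> push_cast <;> linarith
    · have k1 := (avoid y hy (l + 1)).resolve_left fun h => half _ hy _ hc _ h (by linarith)
      have k2 := (avoid y hy (l + 2)).resolve_left fun h => half _ hy _ hc _ h (by linarith)
      constructor <;> push_cast <;> linarith
  · exact (convex_cone l e).isPreconnected.subset_connectedComponentIn hw (cone_subset he)

theorem mem_frontier_cone {l : Fin 3} {e : ℤ} (he : e = 0 ∨ e = 1) {v : V} :
    v ∈ frontier (cone l e) ↔
      (0 ≤ (2 * e - 1) * (bary (l + 1) v - e) ∧ 0 ≤ (2 * e - 1) * (bary (l + 2) v - e)) ∧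
      (bary (l + 1) v = e ∨ bary (l + 2) v = e) := by
  have g : ∀ i, Continuous fun v => (2 * (e : ℝ) - 1) * (bary i v - e) := fun i =>
    continuous_const.mul ((continuous_bary i).sub continuous_const)
  have hsq : (2 * (e : ℝ) - 1) * (2 * e - 1) = 1 := by rcases he with rfl | rfl <;> norm_num
  have hne : (2 * (e : ℝ) - 1) ≠ 0 := fun h => by rw [h] at hsq; norm_num at hsq
  have hcl : v ∈ closure (cone l e) ↔
      0 ≤ (2 * e - 1) * (bary (l + 1) v - e) ∧ 0 ≤ (2 * e - 1) * (bary (l + 2) v - e) := by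
    constructor
    · intro h
      refine closure_minimal (t := {v | 0 ≤ (2 * e - 1) * (bary (l + 1) v - e) ∧
        0 ≤ (2 * e - 1) * (bary (l + 2) v - e)}) (fun u hu => ⟨hu.1.le, hu.2.le⟩) ?_ h
      exact (isClosed_le continuous_const (g _)).inter (isClosed_le continuous_const (g _))
    · rintro ⟨h1, h2⟩
      obtain ⟨c, hb1, hb2⟩ := exists_bary_eq l (bary (l + 1) v + (2 * e - 1))
        (bary (l + 2) v + (2 * e - 1))
      have ht : Filter.Tendsto (fun t : ℝ => v + t • (c - v)) (nhdsWithin 0 (Set.Ioi 0))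
          (nhds v) := by
        have : Continuous fun t : ℝ => v + t • (c - v) := by fun_prop
        simpa using (this.tendsto 0).mono_left nhdsWithin_le_nhds
      refine mem_closure_of_tendsto ht ?_
      filter_upwards [self_mem_nhdsWithin] with t ht
      have ht' : 0 < t := ht
      constructor
      · rw [bary_add_smul, add_sub_cancel, hb1]
        calc 0 < (2 * (e : ℝ) - 1) * (bary (l + 1) v - e) + t := by linarith
          _ = _ := by linear_combination (-t) * hsq
      · rw [bary_add_smul, add_sub_cancel, hb2]
        calc 0 < (2 * (e : ℝ) - 1) * (bary (l + 2) v - e) + t := by linarith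
          _ = _ := by linear_combination (-t) * hsq
  rw [(isOpen_cone l e).frontier_eq, Set.mem_sdiff, hcl]
  refine and_congr_right fun h => ?_
  have z : ∀ x : ℝ, x = e ↔ (2 * (e : ℝ) - 1) * (x - e) = 0 := by
    intro x; rw [mul_eq_zero, or_iff_right hne, sub_eq_zero]
  rw [z, z]
  simp only [cone, Set.mem_ofPred_eq]
  constructor
  · intro hn
    by_contra! hc
    exact hn ⟨h.1.lt_of_ne' hc.1, h.2.lt_of_ne' hc.2⟩
  · rintro (h | h) ⟨h1, h2⟩ <;> linarith

theorem isWall_of_ray {C : Set V} {a : Fin 3} {m : ℤ} {p p' : V} (hp : p ≠ p')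
    (h : ∀ t : ℝ, 0 ≤ t → ∀ v, (∀ i, bary i v = bary i p + t * (bary i p' - bary i p)) →
      v ∈ frontier C ∧ bary a v = m) : IsWall C a (level a m) := by
  refine ⟨p, p' - p, sub_ne_zero.2 hp.symm, fun t ht => ?_⟩
  rw [Set.mem_inter_iff, mem_hyperplane_level]
  refine h t ht _ fun i => ?_
  rw [bary_add_smul, add_sub_cancel]

theorem isWall_cone {l : Fin 3} {e : ℤ} (he : e = 0 ∨ e = 1) :
    IsWall (cone l e) (l + 1) (level (l + 1) e) ∧ IsWall (cone l e) (l + 2) (level (l + 2) e) := by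
  have hsq : (2 * (e : ℝ) - 1) * (2 * e - 1) = 1 := by rcases he with rfl | rfl <;> norm_num
  have hne : (2 * (e : ℝ) - 1) ≠ 0 := fun h => by rw [h] at hsq; norm_num at hsq
  obtain ⟨p, hp1, hp2⟩ := exists_bary_eq l e e
  constructor
  · obtain ⟨p', h1, h2⟩ := exists_bary_eq l e (e + (2 * e - 1))
    refine isWall_of_ray (p := p) (p' := p') (fun h => hne ?_) fun t ht v hv => ?_
    · rw [h, h2] at hp2; linarith
    · have k1 := hv (l + 1)
      have k2 := hv (l + 2)
      rw [h1, hp1] at k1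
      rw [h2, hp2] at k2
      refine ⟨(mem_frontier_cone he).2 ⟨⟨?_, ?_⟩, .inl ?_⟩, ?_⟩
      · rw [k1]; simp
      · rw [k2]
        calc 0 ≤ t := ht
          _ = _ := by linear_combination (-t) * hsq
      all_goals rw [k1]; simp
  · obtain ⟨p', h1, h2⟩ := exists_bary_eq l (e + (2 * e - 1)) e
    refine isWall_of_ray (p := p) (p' := p') (fun h => hne ?_) fun t ht v hv => ?_
    · rw [h, h1] at hp1; linarith
    · have k1 := hv (l + 1)
      have k2 := hv (l + 2)
      rw [h1, hp1] at k1
      rw [h2, hp2] at k2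
      refine ⟨(mem_frontier_cone he).2 ⟨⟨?_, ?_⟩, .inr ?_⟩, ?_⟩
      · rw [k1]
        calc 0 ≤ t := ht
          _ = _ := by linear_combination (-t) * hsq
      all_goals rw [k2]; simp

theorem IsWall.eq_of_cone {l : Fin 3} {e : ℤ} (he : e = 0 ∨ e = 1) {a : Fin 3} {m : ℤ}
    (hm : m = 0 ∨ m = 1) (h : IsWall (cone l e) a (level a m)) :
    (a = l + 1 ∨ a = l + 2) ∧ m = e := by
  obtain ⟨p, d, hd, h⟩ := h
  have key : ∀ t : ℝ, 0 ≤ t → _ := fun t ht => by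
    have := h t ht
    rw [Set.mem_inter_iff, mem_frontier_cone he, mem_hyperplane_level] at this
    exact this
  have k0 := key 0 le_rfl
  have k1 := key 1 zero_le_one
  rw [zero_smul, add_zero] at k0
  rw [one_smul] at k1
  have hs0 := bary_add_bary_add_bary l p
  have hs1 := bary_add_bary_add_bary l (p + d)
  rcases eq_or_eq_add a l with rfl | rfl | rfl
  · exfalso
    rcases he with rfl | rfl
    -- For `e = 0` the frontier has `bary a ≥ 1`, with equality only at the vertex, so it cannot
    -- contain a ray at level 0 or 1. For `e = 1` it has `bary a ≤ -1`.
    · have : p = p + d := by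
        refine eq_of_bary_add a ?_ ?_ <;> rcases hm with rfl | rfl <;> push_cast at k0 k1 <;>
          linarith [k0.1.1.1, k0.1.1.2, k0.2, k1.1.1.1, k1.1.1.2, k1.2]
      exact hd (by simpa using this)
    · rcases hm with rfl | rfl <;> push_cast at k0 <;>
        linarith [k0.1.1.1, k0.1.1.2, k0.2]
  · refine ⟨.inl rfl, ?_⟩
    have := k0.1.1.1
    rw [k0.2] at this
    rcases he with rfl | rfl <;> rcases hm with rfl | rfl <;>
      first | rfl | norm_num at this
  · refine ⟨.inr rfl, ?_⟩
    have := k0.1.1.2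
    rw [k0.2] at this
    rcases he with rfl | rfl <;> rcases hm with rfl | rfl <;>
      first | rfl | norm_num at this

/-! ### Existence and uniqueness of the labels. -/

/-- The labels of the elements whose alcove center lies in `cone l e`. -/
def coneLabels (l : Fin 3) (e : ℤ) : Labels :=
  ⟨l + 1, level (l + 1) e, l + 2, level (l + 2) e, l, level l (1 - e)⟩

theorem infDist_lt_of_mem_cone {l : Fin 3} {e : ℤ} (he : e = 0 ∨ e = 1) {v : V}
    (hv : v ∈ cone l e) :
    Metric.infDist v (hyperplane l (level l (1 - e))) <
      Metric.infDist v (hyperplane l (level l e)) := by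
  rw [infDist_hyperplane_level, infDist_hyperplane_level]
  refine div_lt_div_of_pos_right ?_ (by positivity)
  have hs := bary_add_bary_add_bary l v
  obtain ⟨h1, h2⟩ := hv
  rw [← sq_lt_sq]
  rcases he with rfl | rfl <;> push_cast at h1 h2 ⊢ <;> nlinarith

theorem isFor_coneLabels {w : W} {l : Fin 3} {e : ℤ} (he : e = 0 ∨ e = 1)
    (hw : center w ∈ cone l e) : (coneLabels l e).IsFor w := by
  have hch := chamber_eq_cone he hw
  have hsq : (2 * (e : ℝ) - 1) * (2 * e - 1) = 1 := by rcases he with rfl | rfl <;> norm_num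
  refine ⟨?_, ?_, ?_, level_mem' he, level_mem' he, level_mem' (by omega), ?_, ?_, ?_, ?_⟩
  · change l + 1 ≠ l + 2; clear hw hch; revert l; decide
  · change l ≠ l + 1; clear hw hch; revert l; decide
  · change l ≠ l + 2; clear hw hch; revert l; decide
  · rw [hch]; exact (isWall_cone he).1
  · rw [hch]; exact (isWall_cone he).2
  · obtain ⟨v, h1, h2⟩ := exists_bary_eq l e e
    refine ⟨v, ⟨mem_hyperplane_level.2 h1, mem_hyperplane_level.2 h2⟩, ?_⟩
    rintro p ⟨hp, hp1⟩ hne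
    rw [hch, mem_frontier_cone he] at hp
    replace hp1 : bary (l + 1) p = e := mem_hyperplane_level.1 hp1
    have hp2 : (2 * (e : ℝ) - 1) * (bary (l + 2) p - e) ≠ 0 := by
      intro h
      have : bary (l + 2) p - e = 0 := by
        linear_combination (2 * (e : ℝ) - 1) * h - (bary (l + 2) p - e) * hsq
      exact hne (eq_of_bary_add l (by rw [hp1, h1]) (by rw [h2]; linarith))
    rw [cross_pos_iff l, h1, h2, hp1, sub_self, mul_zero, sub_zero]
    have := mul_pos hw.1 (hp.1.2.lt_of_ne' hp2)
    calc 0 < _ := this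
      _ = _ := by
        linear_combination ((bary (l + 1) (center w) - e) * (bary (l + 2) p - e)) * hsq
  · have := infDist_lt_of_mem_cone he hw
    change Metric.infDist _ (hyperplane l (level l (1 - e))) <
      Metric.infDist _ (hyperplane l (1 - level l (1 - e)))
    rwa [← level_one_sub, sub_sub_cancel]

theorem Labels.IsFor.eq_coneLabels {w : W} {l : Fin 3} {e : ℤ} (he : e = 0 ∨ e = 1)
    (hw : center w ∈ cone l e) {d : Labels} (hd : d.IsFor w) : d = coneLabels l e := by
  obtain ⟨α, i, β, j, γ, k⟩ := d
  obtain ⟨hαβ, hγα, hγβ, hi, hj, hk, wα, wβ, ccw, near⟩ := hd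
  dsimp only at *
  have hch := chamber_eq_cone he hw
  obtain ⟨i, rfl⟩ : ∃ i', i = level α i' := ⟨level α i, (level_level _ _).symm⟩
  obtain ⟨j, rfl⟩ : ∃ j', j = level β j' := ⟨level β j, (level_level _ _).symm⟩
  obtain ⟨k, rfl⟩ : ∃ k', k = level γ k' := ⟨level γ k, (level_level _ _).symm⟩
  rw [level_mem] at hi hj hk
  rw [hch] at wα wβ ccw
  obtain ⟨cα, rfl⟩ := wα.eq_of_cone he hi
  obtain ⟨cβ, rfl⟩ := wβ.eq_of_cone he hj
  have hsq : (2 * (j : ℝ) - 1) * (2 * j - 1) = 1 := by rcases he with rfl | rfl <;> norm_num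
  have hα : α = l + 1 := by
    refine cα.resolve_right fun hα => ?_
    have hβ : β = l + 1 := cβ.resolve_right fun h => hαβ (hα.trans h.symm)
    subst hα hβ
    obtain ⟨v, ⟨hv2, hv1⟩, hv⟩ := ccw
    rw [mem_hyperplane_level] at hv1 hv2
    -- A point of the other wall, one unit from the vertex: with the two walls exchanged, the
    -- orientation determinant at it is negative.
    obtain ⟨p, hp1, hp2⟩ := exists_bary_eq l (j + (2 * j - 1)) j
    have hpv : p ≠ v := by
      rintro rfl
      have : (2 * (j : ℝ) - 1) = 0 := by linarith
      rw [this] at hsq; norm_num at hsq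
    have := hv p ⟨(mem_frontier_cone he).2 ⟨⟨?_, ?_⟩, .inr hp2⟩, mem_hyperplane_level.2 hp2⟩ hpv
    · rw [cross_pos_iff l, hp1, hp2, hv1, hv2] at this
      linarith [hw.2]
    · rw [hp1]; linarith
    · rw [hp2]; simp
  subst hα
  have hβ : β = l + 2 := cβ.resolve_left fun h => hαβ h.symm
  subst hβ
  have hγ : γ = l := by
    clear wα wβ ccw cα cβ near hαβ hch hw
    revert l γ; decide
  subst hγ
  have hk' : k = 1 - j := by
    by_contra hne
    have : k = j := by omega
    subst this
    have h := infDist_lt_of_mem_cone he hw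
    rw [level_one_sub] at h
    exact lt_asymm near h
  rw [hk']; rfl

theorem existsUnique_labels {w : W} (hw : ¬ IsSpiral w) : ∃! d : Labels, d.IsFor w := by
  obtain ⟨l, e, he, h⟩ := exists_center_mem_cone hw
  exact ⟨coneLabels l e, isFor_coneLabels he h, fun d hd => hd.eq_coneLabels he h⟩

/-! ### Convex hexagons as intersections of half-planes. -/

theorem mem_convexHull_triangle {a b c y : V} (hD : 0 < cross (b - a) (c - a))
    (h1 : 0 ≤ cross (b - a) (y - a)) (h2 : 0 ≤ cross (c - b) (y - b))
    (h3 : 0 ≤ cross (a - c) (y - c)) : y ∈ convexHull ℝ {a, b, c} := by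
  set D := cross (b - a) (c - a) with hDdef
  have hne := hD.ne'
  have hs : cross (c - b) (y - b) / D + cross (a - c) (y - c) / D +
      cross (b - a) (y - a) / D = 1 := by
    rw [← add_div, ← add_div, div_eq_one_iff_eq hne, hDdef]
    simp only [cross, PiLp.sub_apply]; ring
  have hy : y = (cross (c - b) (y - b) / D) • a + (cross (a - c) (y - c) / D) • b +
      (cross (b - a) (y - a) / D) • c := by
    ext i
    simp only [PiLp.add_apply, PiLp.smul_apply, smul_eq_mul]
    rw [div_mul_eq_mul_div, div_mul_eq_mul_div, div_mul_eq_mul_div, ← add_div, ← add_div,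
      eq_div_iff hne, hDdef]
    fin_cases i <;> simp only [cross, PiLp.sub_apply, Fin.mk_zero, Fin.mk_one] <;> ring
  have hmem := (convex_convexHull ℝ ({a, b, c} : Set V)).sum_mem (t := Finset.univ)
    (w := ![cross (c - b) (y - b) / D, cross (a - c) (y - c) / D, cross (b - a) (y - a) / D])
    (z := ![a, b, c])
    (by intro i _; fin_cases i <;> simp <;> positivity)
    (by simpa [Fin.sum_univ_three] using hs)
    (by intro i _; apply subset_convexHull; fin_cases i <;> simp)
  rw [hy]
  simpa [Fin.sum_univ_three] using hmem

theorem IsConvexHexagon.mem_convexHull_iff {P : Fin 6 → V} (hP : IsConvexHexagon P) {y : V} :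
    y ∈ convexHull ℝ (Set.range P) ↔ ∀ m, 0 ≤ cross (P (m + 1) - P m) (y - P m) := by
  constructor
  · intro hy
    refine convexHull_min (t := {y | ∀ m, 0 ≤ cross (P (m + 1) - P m) (y - P m)}) ?_ ?_ hy
    · rintro _ ⟨n, rfl⟩ m
      by_cases h1 : n = m
      · subst h1; simp [cross]
      by_cases h2 : n = m + 1
      · subst h2; simp only [cross]; linarith
      exact (hP m n h1 h2).le
    · intro u hu v hv a b ha hb hab m
      have : cross (P (m + 1) - P m) (a • u + b • v - P m) =
          a * cross (P (m + 1) - P m) (u - P m) + b * cross (P (m + 1) - P m) (v - P m) := by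
        obtain rfl : a = 1 - b := by linarith
        simp only [cross, PiLp.sub_apply, PiLp.add_apply, PiLp.smul_apply, smul_eq_mul]; ring
      rw [this]
      exact add_nonneg (mul_nonneg ha (hu m)) (mul_nonneg hb (hv m))
  · intro h
    -- Fan triangulation from `P 0`: the sign of `cross (P m - P 0) (y - P 0)` changes at some
    -- consecutive pair of diagonals or sides, and `y` lies in that triangle.
    have tri : ∀ m : Fin 6, 0 ≤ cross (P m - P 0) (y - P 0) →
        cross (P (m + 1) - P 0) (y - P 0) ≤ 0 → m ≠ 0 → m + 1 ≠ 0 →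
        y ∈ convexHull ℝ (Set.range P) := by
      intro m h1 h2 hm hm'
      have hsub : ({P 0, P m, P (m + 1)} : Set V) ⊆ Set.range P := by
        rintro _ (rfl | rfl | rfl) <;> exact ⟨_, rfl⟩
      have hD := hP m 0 hm.symm hm'.symm
      refine convexHull_mono hsub (mem_convexHull_triangle ?_ h1 (h m) ?_)
      · calc 0 < _ := hD
          _ = _ := by simp only [cross, PiLp.sub_apply]; ring
      · calc 0 ≤ -cross (P (m + 1) - P 0) (y - P 0) := by linarith
          _ = _ := by simp only [cross, PiLp.sub_apply]; ring
    have h5 : cross (P (4 + 1) - P 0) (y - P 0) ≤ 0 := by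
      have := h 5
      calc _ = -cross (P (5 + 1) - P 5) (y - P 5) := by
            rw [show (5 + 1 : Fin 6) = 0 from rfl, show (4 + 1 : Fin 6) = 5 from rfl]
            simp only [cross, PiLp.sub_apply]; ring
        _ ≤ 0 := by linarith
    have h1 : 0 ≤ cross (P 1 - P 0) (y - P 0) := h 0
    rcases le_total (cross (P 2 - P 0) (y - P 0)) 0 with h2 | h2
    · exact tri 1 h1 h2 (by decide) (by decide)
    rcases le_total (cross (P 3 - P 0) (y - P 0)) 0 with h3 | h3
    · exact tri 2 h2 h3 (by decide) (by decide)
    rcases le_total (cross (P 4 - P 0) (y - P 0)) 0 with h4 | h4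
    · exact tri 3 h3 h4 (by decide) (by decide)
    · exact tri 4 h4 h5 (by decide) (by decide)

/-! ### The hexagon of an element in integral coordinates. -/

/-- The scaled barycentric coordinates `l + 1` and `l + 2` of the vertices of the hexagon of the
point `(X, Y)`, where `e` is as in `cone`. -/
def vertexCoord (e X Y : ℤ) : Fin 6 → ℤ × ℤ :=
  ![(X, Y), (6 * e - X, X + Y - 3 * e), (6 * e - X - Y, X - 3 * e), (3 * e - Y, 3 * e - X),
    (Y - 3 * e, 6 * e - X - Y), (X + Y - 3 * e, 6 * e - Y)]

theorem coord_vertex {l : Fin 3} (e : ℤ) (w : W) (m : Fin 6) :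
    (coord ((coneLabels l e).vertex w m) (l + 1), coord ((coneLabels l e).vertex w m) (l + 2)) =
      vertexCoord e (coord w (l + 1)) (coord w (l + 2)) m := by
  have h12 : l + 1 ≠ l + 2 := by revert l; decide
  have h01 : l + 1 ≠ l := by revert l; decide
  have h02 : l + 2 ≠ l := by revert l; decide
  have hs := coord_add w l
  have hv : (coneLabels l e).vertex w = ![w, baryRefl (l + 1) e * w,
      baryRefl l (1 - e) * (baryRefl (l + 1) e * w), baryRefl l (1 - e) * w,
      baryRefl l (1 - e) * (baryRefl (l + 2) e * w), baryRefl (l + 2) e * w] := rfl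
  rw [hv]
  fin_cases m <;>
    simp [vertexCoord, coord_baryRefl_self, coord_baryRefl_of_ne _ h12,
      coord_baryRefl_of_ne _ h12.symm, coord_baryRefl_of_ne _ h01, coord_baryRefl_of_ne _ h02,
      coord_baryRefl_of_ne _ h01.symm, coord_baryRefl_of_ne _ h02.symm] <;>
    first | (constructor <;> linarith) | linarith

/-- The oriented area spanned by `a - b` and `c - d`, in integral coordinates. -/
def intCross (a b c d : ℤ × ℤ) : ℤ := (a.1 - b.1) * (c.2 - d.2) - (a.2 - b.2) * (c.1 - d.1)

theorem nine_mul_sqrt_three_mul_cross (l : Fin 3) (a b c d : W) :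
    9 * √3 * cross (center a - center b) (center c - center d) =
      intCross (coord a (l + 1), coord a (l + 2)) (coord b (l + 1), coord b (l + 2))
        (coord c (l + 1), coord c (l + 2)) (coord d (l + 1), coord d (l + 2)) := by
  rw [mul_assoc, sqrt_three_mul_cross_sub l]
  simp only [intCross]
  push_cast
  simp only [coord_cast]
  ring

theorem cross_center_pos_iff (l : Fin 3) (a b c d : W) :
    0 < cross (center a - center b) (center c - center d) ↔
      0 < intCross (coord a (l + 1), coord a (l + 2)) (coord b (l + 1), coord b (l + 2))
        (coord c (l + 1), coord c (l + 2)) (coord d (l + 1), coord d (l + 2)) := by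
  rw [← mul_pos_iff_of_pos_left (show 0 < 9 * √3 by positivity), nine_mul_sqrt_three_mul_cross l,
    Int.cast_pos]

theorem cross_center_nonneg_iff (l : Fin 3) (a b c d : W) :
    0 ≤ cross (center a - center b) (center c - center d) ↔
      0 ≤ intCross (coord a (l + 1), coord a (l + 2)) (coord b (l + 1), coord b (l + 2))
        (coord c (l + 1), coord c (l + 2)) (coord d (l + 1), coord d (l + 2)) := by
  rw [← mul_nonneg_iff_of_pos_left (show 0 < 9 * √3 by positivity),
    nine_mul_sqrt_three_mul_cross l, Int.cast_nonneg_iff]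

/-- The forms that vanish on the sides of the hexagon of `(X, Y)`, without the scaling factor. -/
theorem intCross_vertexCoord (e X Y : ℤ) (p : ℤ × ℤ) (m : Fin 6) :
    intCross (vertexCoord e X Y (m + 1)) (vertexCoord e X Y m) p (vertexCoord e X Y m) =
      ![(X - 3 * e) * (X + 2 * Y - (p.1 + 2 * p.2)), Y * ((p.1 - p.2) - (9 * e - 2 * X - Y)),
        (X - 3 * e) * (2 * p.1 + p.2 - (9 * e - X - 2 * Y)),
        (Y - 3 * e) * (p.1 + 2 * p.2 - (9 * e - 2 * X - Y)),
        X * (X + 2 * Y - 9 * e - (p.1 - p.2)), (Y - 3 * e) * (2 * X + Y - (2 * p.1 + p.2))] m := by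
  fin_cases m <;> simp [intCross, vertexCoord] <;> ring

theorem intCross_vertexCoord_pos {e X Y : ℤ}
    (h : (e = 0 ∧ X < 0 ∧ Y < 0) ∨ (e = 1 ∧ 3 < X ∧ 3 < Y)) {m n : Fin 6} (hm : n ≠ m)
    (hn : n ≠ m + 1) : 0 < intCross (vertexCoord e X Y (m + 1)) (vertexCoord e X Y m)
      (vertexCoord e X Y n) (vertexCoord e X Y m) := by
  rw [intCross_vertexCoord]
  rcases h with ⟨rfl, hX, hY⟩ | ⟨rfl, hX, hY⟩
  · have h1 := mul_pos_of_neg_of_neg hX hX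
    have h2 := mul_pos_of_neg_of_neg hX hY
    have h3 := mul_pos_of_neg_of_neg hY hY
    fin_cases m <;> fin_cases n <;> first | exact absurd rfl hm | exact absurd rfl hn | skip
    all_goals
      simp [vertexCoord]
      linarith
  -- Measured from the vertex of the cone, the areas become combinations of monomials in `a, b > 0`
  -- with nonnegative coefficients; the quadratic ones are supplied to `linarith` as atoms.
  · obtain ⟨a, rfl⟩ : ∃ a, X = 3 + a := ⟨X - 3, by ring⟩
    obtain ⟨b, rfl⟩ : ∃ b, Y = 3 + b := ⟨Y - 3, by ring⟩
    have ha : 0 < a := by omega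
    have hb : 0 < b := by omega
    have h1 := mul_pos ha ha
    have h2 := mul_pos ha hb
    have h3 := mul_pos hb hb
    fin_cases m <;> fin_cases n <;> first | exact absurd rfl hm | exact absurd rfl hn | skip
    all_goals
      simp [vertexCoord]
      linarith

theorem forall_nonneg_vec_six {a b c d f g : ℤ} : (∀ m, 0 ≤ ![a, b, c, d, f, g] m) ↔
    0 ≤ a ∧ 0 ≤ b ∧ 0 ≤ c ∧ 0 ≤ d ∧ 0 ≤ f ∧ 0 ≤ g := by
  simp [Fin.forall_fin_succ]

theorem forall_intCross_nonneg_iff_negHex {X Y x y : ℤ} (hX : X < 0) (hY : Y < 0) :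
    (∀ m, 0 ≤ intCross (vertexCoord 0 X Y (m + 1)) (vertexCoord 0 X Y m) (x, y)
      (vertexCoord 0 X Y m)) ↔ NegHex X Y x y := by
  have N : ∀ {a b : ℤ}, a < 0 → (0 ≤ a * b ↔ b ≤ 0) := fun {a b} h => by
    rw [← neg_mul_neg, mul_nonneg_iff_of_pos_left (by omega)]; omega
  simp only [intCross_vertexCoord]
  rw [forall_nonneg_vec_six, N (by omega), N hY, N (by omega), N (by omega), N hX, N (by omega)]
  unfold NegHex
  constructor
  · rintro ⟨h1, h2, h3, h4, h5, h6⟩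
    refine ⟨?_, ?_, ?_, ?_, ?_, ?_⟩ <;> omega
  · rintro ⟨h1, h2, h3, h4, h5, h6⟩
    refine ⟨?_, ?_, ?_, ?_, ?_, ?_⟩ <;> omega

theorem forall_intCross_nonneg_iff_posHex {X Y x y : ℤ} (hX : 3 < X) (hY : 3 < Y) :
    (∀ m, 0 ≤ intCross (vertexCoord 1 X Y (m + 1)) (vertexCoord 1 X Y m) (x, y)
      (vertexCoord 1 X Y m)) ↔ PosHex X Y x y := by
  have N : ∀ {a b : ℤ}, 0 < a → (0 ≤ a * b ↔ 0 ≤ b) := mul_nonneg_iff_of_pos_left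
  simp only [intCross_vertexCoord]
  rw [forall_nonneg_vec_six, N (by omega), N (by omega), N (by omega), N (by omega), N (by omega),
    N (by omega)]
  unfold PosHex
  constructor
  · rintro ⟨h1, h2, h3, h4, h5, h6⟩
    refine ⟨?_, ?_, ?_, ?_, ?_, ?_⟩ <;> omega
  · rintro ⟨h1, h2, h3, h4, h5, h6⟩
    refine ⟨?_, ?_, ?_, ?_, ?_, ?_⟩ <;> omega

theorem coord_of_center_mem_cone {w : W} {l : Fin 3} {e : ℤ} (he : e = 0 ∨ e = 1)
    (hw : center w ∈ cone l e) :
    (e = 0 ∧ coord w (l + 1) < 0 ∧ coord w (l + 2) < 0) ∨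
      (e = 1 ∧ 3 < coord w (l + 1) ∧ 3 < coord w (l + 2)) := by
  obtain ⟨h1, h2⟩ := hw
  have c1 := coord_cast w (l + 1)
  have c2 := coord_cast w (l + 2)
  rcases he with rfl | rfl <;> push_cast at h1 h2
  · refine .inl ⟨rfl, ?_, ?_⟩
    · have : (coord w (l + 1) : ℝ) < 0 := by linarith
      exact_mod_cast this
    · have : (coord w (l + 2) : ℝ) < 0 := by linarith
      exact_mod_cast this
  · refine .inr ⟨rfl, ?_, ?_⟩
    · have : (3 : ℝ) < coord w (l + 1) := by linarith
      exact_mod_cast this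
    · have : (3 : ℝ) < coord w (l + 2) := by linarith
      exact_mod_cast this

theorem isConvexHexagon_vertex {w : W} {l : Fin 3} {e : ℤ} (he : e = 0 ∨ e = 1)
    (hw : center w ∈ cone l e) :
    IsConvexHexagon fun m => center ((coneLabels l e).vertex w m) := by
  intro m n hm hn
  rw [cross_center_pos_iff l, coord_vertex, coord_vertex, coord_vertex]
  exact intCross_vertexCoord_pos (coord_of_center_mem_cone he hw) hm hn

theorem center_mem_hexagon_iff {w : W} {l : Fin 3} {e : ℤ} (he : e = 0 ∨ e = 1)
    (hw : center w ∈ cone l e) {x : W} :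
    center x ∈ (coneLabels l e).hexagon w ↔
      ∀ m, 0 ≤ intCross (vertexCoord e (coord w (l + 1)) (coord w (l + 2)) (m + 1))
        (vertexCoord e (coord w (l + 1)) (coord w (l + 2)) m) (coord x (l + 1), coord x (l + 2))
        (vertexCoord e (coord w (l + 1)) (coord w (l + 2)) m) := by
  rw [Labels.hexagon, (isConvexHexagon_vertex he hw).mem_convexHull_iff]
  refine forall_congr' fun m => ?_
  rw [cross_center_nonneg_iff l, coord_vertex, coord_vertex]

/-! ### Lower Bruhat intervals are hexagons. -/

/-- The steps of `bruhatLE_iff_of_steps` for a set that is given by the scaled barycentric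
coordinates `l + 1` and `l + 2`. -/
theorem bruhatLE_iff_of_coord_steps {w : W} (l : Fin 3) {S : ℤ → ℤ → Prop}
    (hw : S (coord w (l + 1)) (coord w (l + 2)))
    (down1 : ∀ x y m, Ascends x m → S (6 * m - x) (y + x - 3 * m) → S x y)
    (down2 : ∀ x y m, Ascends y m → S (x + y - 3 * m) (6 * m - y) → S x y)
    (down0 : ∀ x y m, Ascends (3 - x - y) m → S (3 - y - 3 * m) (3 - x - 3 * m) → S x y)
    (up : ∀ x y, x % 3 = y % 3 → x % 3 ≠ 0 → S x y →
      ¬ (x = coord w (l + 1) ∧ y = coord w (l + 2)) →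
      (∃ m, Ascends x m ∧ S (6 * m - x) (y + x - 3 * m)) ∨
      (∃ m, Ascends y m ∧ S (x + y - 3 * m) (6 * m - y)) ∨
      (∃ m, Ascends (3 - x - y) m ∧ S (3 - y - 3 * m) (3 - x - 3 * m)))
    (N : ℤ) (bdd : ∀ x y, S x y → sepCount (3 - x - y) x y ≤ N) (x : W) :
    BruhatLE x w ↔ S (coord x (l + 1)) (coord x (l + 2)) := by
  have h12 : l + 1 ≠ l + 2 := by clear hw up; revert l; decide
  have h01 : l + 1 ≠ l := by clear hw up; revert l; decide
  have h02 : l + 2 ≠ l := by clear hw up; revert l; decide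
  have c0 : ∀ x, coord x l = 3 - coord x (l + 1) - coord x (l + 2) := fun x => by
    linarith [coord_add x l]
  have r0 : ∀ x m, S (coord (baryRefl l m * x) (l + 1)) (coord (baryRefl l m * x) (l + 2)) ↔
      S (3 - coord x (l + 2) - 3 * m) (3 - coord x (l + 1) - 3 * m) := fun x m => by
    rw [coord_baryRefl_of_ne _ h01, coord_baryRefl_of_ne _ h02, c0]
    ring_nf
  have r1 : ∀ x m, S (coord (baryRefl (l + 1) m * x) (l + 1))
      (coord (baryRefl (l + 1) m * x) (l + 2)) ↔
      S (6 * m - coord x (l + 1)) (coord x (l + 2) + coord x (l + 1) - 3 * m) := fun x m => by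
    rw [coord_baryRefl_self, coord_baryRefl_of_ne _ h12.symm]
  have r2 : ∀ x m, S (coord (baryRefl (l + 2) m * x) (l + 1))
      (coord (baryRefl (l + 2) m * x) (l + 2)) ↔
      S (coord x (l + 1) + coord x (l + 2) - 3 * m) (6 * m - coord x (l + 2)) := fun x m => by
    rw [coord_baryRefl_self, coord_baryRefl_of_ne _ h12]
  refine bruhatLE_iff_of_steps (S := fun x => S (coord x (l + 1)) (coord x (l + 2))) hw ?_ ?_ N ?_ x
  · intro x i m ha hS
    rcases eq_or_eq_add i l with rfl | rfl | rfl
    · exact down0 _ _ m (c0 x ▸ ha) ((r0 x m).1 hS)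
    · exact down1 _ _ m ha ((r1 x m).1 hS)
    · exact down2 _ _ m ha ((r2 x m).1 hS)
  · intro x hx hne
    rcases up _ _ (coord_emod x _ _) (coord_emod_ne x _) hx fun h => hne (eq_of_coord l h.1 h.2)
      with ⟨m, ha, hS⟩ | ⟨m, ha, hS⟩ | ⟨m, ha, hS⟩
    · exact ⟨l + 1, m, ha, (r1 x m).2 hS⟩
    · exact ⟨l + 2, m, ha, (r2 x m).2 hS⟩
    · exact ⟨l, m, (c0 x).symm ▸ ha, (r0 x m).2 hS⟩
  · intro x hx
    rw [sep_eq x l, c0]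
    exact bdd _ _ hx

theorem sepCount_le {x y z K : ℤ} (hx : -K ≤ x ∧ x ≤ K) (hy : -K ≤ y ∧ y ≤ K)
    (hz : -K ≤ z ∧ z ≤ K) : sepCount x y z ≤ 3 * K + 3 := by
  have key : ∀ t : ℤ, -K ≤ t ∧ t ≤ K → |t / 3| ≤ K + 1 := fun t ht => by
    rw [abs_le]; omega
  unfold sepCount
  linarith [key x hx, key y hy, key z hz]

theorem bruhatLE_iff_negHex {w : W} {l : Fin 3} (hX : coord w (l + 1) < 0)
    (hY : coord w (l + 2) < 0) (x : W) :
    BruhatLE x w ↔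
      NegHex (coord w (l + 1)) (coord w (l + 2)) (coord x (l + 1)) (coord x (l + 2)) := by
  refine bruhatLE_iff_of_coord_steps l (by unfold NegHex; omega)
    (fun x y m ha h => h.of_ascends ha)
    (fun x y m ha h => (NegHex.of_ascends ha h.swap).swap)
    (fun x y m ha h => h.of_ascends' ha)
    (fun x y h1 h2 h h3 => h.exists_ascends hX hY (coord_emod w _ _) (coord_emod_ne w _) h1 h2 h3)
    -- A crude bound: on the hexagon all three coordinates are at most `3 - 2 * (X + Y)` in absolute
    -- value, and `sepCount_le` applies.
    (3 * (3 - 2 * (coord w (l + 1) + coord w (l + 2))) + 3) (fun x y h => ?_) x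
  unfold NegHex at h
  exact sepCount_le (by omega) (by omega) (by omega)

theorem bruhatLE_iff_posHex {w : W} {l : Fin 3} (hX : 3 < coord w (l + 1))
    (hY : 3 < coord w (l + 2)) (x : W) :
    BruhatLE x w ↔
      PosHex (coord w (l + 1)) (coord w (l + 2)) (coord x (l + 1)) (coord x (l + 2)) := by
  refine bruhatLE_iff_of_coord_steps l (by unfold PosHex; omega)
    (fun x y m ha h => h.of_ascends ha)
    (fun x y m ha h => (PosHex.of_ascends ha h.swap).swap)
    (fun x y m ha h => h.of_ascends' ha)
    (fun x y h1 h2 h h3 => h.exists_ascends hX hY (coord_emod w _ _) (coord_emod_ne w _) h1 h2 h3)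
    (3 * (3 + 2 * (coord w (l + 1) + coord w (l + 2))) + 3) (fun x y h => ?_) x
  unfold PosHex at h
  exact sepCount_le (by omega) (by omega) (by omega)

theorem bruhatLE_iff_center_mem_hexagon {w : W} {l : Fin 3} {e : ℤ} (he : e = 0 ∨ e = 1)
    (hw : center w ∈ cone l e) (x : W) :
    BruhatLE x w ↔ center x ∈ (coneLabels l e).hexagon w := by
  rw [center_mem_hexagon_iff he hw]
  rcases coord_of_center_mem_cone he hw with ⟨rfl, hX, hY⟩ | ⟨rfl, hX, hY⟩
  · rw [forall_intCross_nonneg_iff_negHex hX hY, bruhatLE_iff_negHex hX hY]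
  · rw [forall_intCross_nonneg_iff_posHex hX hY, bruhatLE_iff_posHex hX hY]

end AffineA2

/-- For a non-spiral `w`, the three hyperplanes that define its hexagon exist and are unique, the
six points obtained from them are the vertices of a convex hexagon in counterclockwise order, and
`x ≤ w` holds exactly when the alcove center of `x` lies on or inside this hexagon. -/
theorem theoremt (w : AffineA2.W) (hw : ¬ AffineA2.IsSpiral w) :
    (∃! d : AffineA2.Labels, d.IsFor w) ∧
    ∀ d : AffineA2.Labels, d.IsFor w →
      AffineA2.IsConvexHexagon (fun m => AffineA2.center (d.vertex w m)) ∧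
      {x : AffineA2.W | AffineA2.BruhatLE x w} =
        {x : AffineA2.W | AffineA2.center x ∈ d.hexagon w} := by
  refine ⟨AffineA2.existsUnique_labels hw, fun d hd => ?_⟩
  obtain ⟨l, e, he, h⟩ := AffineA2.exists_center_mem_cone hw
  obtain rfl := hd.eq_coneLabels he h
  exact ⟨AffineA2.isConvexHexagon_vertex he h,
    Set.ext fun x => AffineA2.bruhatLE_iff_center_mem_hexagon he h x⟩
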